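/- **Model.** There are a finite set $\mathcal A$ of $K$ actions, $d\ge 1$ resources, $T\ge 1$ rounds, and a budget $B=bT$ (with $b>0$) of each resource. Fixed demand volumes $q_1,\dots,q_T\in[\underline q,\overline q]$, $0<\underline q<\overline q$, have total $Q=\sum_{t=1}^T q_t$. For every action $a$ and round $t$ there is a probability law $P_{a,t}$ on $[0,1]^{d+1}$ whose mean $(r(a);c(a,1),\dots,c(a,d))$ does not depend on $t$; a null action $a_0\in\mathcal A$ always gives zero reward and zero consumption. For each $t\in[T]$ an oracle maps $(q_1,\dots,q_{t-1})$ to a prediction $\hat Q_t\in[\underline qT,\overline qT]$ of $Q$. In round $t$ the decision maker receives $\hat Q_t$, chooses $A_t$ on the basis of the past, and then observes $q_t$ and an outcome $(R_t;C_{t,1},\dots,C_{t,d})$ which, given the past, has law $P_{A_t,t}$. Let $\tau$ be the first $t\in[T]$ with $\sum_{s\le t}q_sC_{s,j}>B$ for some $j\in[d]$, and $\tau=T+1$ if there is none. Let $$\mathrm{OPT}_{\mathrm{LP}}=\max\Big\{Q\sum_a r(a)u_a : u\ge 0,\ \sum_a u_a=1,\ Q\sum_a c(a,i)u_a\le B\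 \ \forall i\in[d]\Big\}.$$ **OA-UCB with parameter $\delta>0$.** Put $\mathrm{rad}(v,N,\delta)=\sqrt{2v\log(1/\delta)/N}+4\log(1/\delta)/N$. Let $N_{t-1}^+(a)$ be the maximum of $1$ and the number of pulls of $a$ before round $t$, and let $\hat R_t(a),\hat C_t(a,i)$ be the sums of the rewards and of the consumptions observed in those pulls, divided by $N_{t-1}^+(a)$. Put $$\mathrm{UCB}_{r,t}(a)=\min\{\hat R_t(a)+\mathrm{rad}(\hat R_t(a),N_{t-1}^+(a),\delta),1\},$$ $$\mathrm{LCB}_{c,t}(a,i)=\max\{\hat C_t(a,i)-\mathrm{rad}(\hat C_t(a,i),N_{t-1}^+(a),\delta),0\}\ (i\in[d]),\qquad \mathrm{LCB}_{c,t}(a,d+1)=0.$$ In every round $t\le\min\{\tau,T\}$ the algorithm chooses (with arbitrary tie-breaking) $$A_t\in\arg\max_{a}\Big\{\mathrm{UCB}_{r,t}(a)-\frac{\hat Q_t}{B}\sum_{j=1}^{d+1}\mu_{t,j}\,\mathrm{LCB}_{c,t}(a,j)\Big\},$$ and $A_t=a_0$ for $t>\tau$. The weights are $\mu_{1,j}=\frac1{d+1}$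 and, for $t\ge 2$, $\mu_{t,j}=e^{\theta_{t,j}/\eta_t}/\sum_i e^{\theta_{t,i}/\eta_t}$, where $\theta_1=0$, $\eta_1=0$, $\theta_{t+1}=\theta_t-g_t$, $\eta_{t+1}=\eta_t+\rho_t/\ln(d+1)$, with $$g_{t,j}=\frac{q_t\hat Q_t}{B}\Big(\frac{B}{\hat Q_t}\beta_j-\mathrm{LCB}_{c,t}(A_t,j)\Big),\qquad \beta=(1,\dots,1,0)\in\mathbb R^{d+1},$$ $\rho_1=g_1^\top\mu_1-\min_j g_{1,j}$, and $\rho_t=\eta_t\ln\big(\sum_{j=1}^{d+1}\mu_{t,j}e^{-g_{t,j}/\eta_t}\big)+g_t^\top\mu_t$ for $t\ge2$. **Theorem.** There is an absolute constant $c>0$ such that, for every such instance and oracle, every $\delta>0$ and all numbers $\epsilon_t$ with $|\hat Q_t-Q|\le\epsilon_t$ for all $t\in[T]$ (the algorithm does not use the $\epsilon_t$), OA-UCB satisfies, with probability at least $1-3KTd\,\delta$, $$\mathrm{OPT}_{\mathrm{LP}}-\sum_{t=1}^{\tau-1}q_tR_t\le c\Big[\Big(\mathrm{OPT}_{\mathrm{LP}}\sqrt{\tfrac{\overline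 qK}{B}}+\sqrt{\overline qK\,\mathrm{OPT}_{\mathrm{LP}}}\Big)\log\tfrac1\delta+\Big(\tfrac1Q+\tfrac1B\Big)\sum_{t=1}^{\tau-1}q_t\epsilon_t+\Big(\overline q+\tfrac{\overline q^2}{b}\Big)\sqrt{(\tau-1)\ln(d+1)}\Big].$$ -/

import Mathlib

open MeasureTheory ProbabilityTheory

noncomputable section

namespace OAUCB

/-- An instance of bandits with knapsacks with non-stationary demand: a set `𝒜` of actions, `d`
resources, rounds `1, …, T`, budget `B = b T` of every resource, demand volumes `q t`, and laws
`P a t` of the per-unit outcome (reward, consumption of each resource) of action `a` in round `t`.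
Only rounds `1 ≤ t ≤ T` matter. The laws may vary over time, their means may not. -/
structure Instance (𝒜 : Type*) (d : ℕ) where
  T : ℕ
  b : ℝ
  qlo : ℝ
  qhi : ℝ
  q : ℕ → ℝ
  P : 𝒜 → ℕ → Measure (ℝ × (Fin d → ℝ))
  r : 𝒜 → ℝ
  c : 𝒜 → Fin d → ℝ
  nullAction : 𝒜
  one_le_d : 1 ≤ d
  one_le_T : 1 ≤ T
  b_pos : 0 < b
  qlo_pos : 0 < qlo
  qlo_lt_qhi : qlo < qhi
  q_mem : ∀ t ∈ Finset.Icc 1 T, q t ∈ Set.Icc qlo qhi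
  isProbabilityMeasure : ∀ a, ∀ t ∈ Finset.Icc 1 T, IsProbabilityMeasure (P a t)
  mem_unit : ∀ a, ∀ t ∈ Finset.Icc 1 T,
    ∀ᵐ x ∂(P a t), x.1 ∈ Set.Icc (0 : ℝ) 1 ∧ ∀ i, x.2 i ∈ Set.Icc (0 : ℝ) 1
  mean_reward : ∀ a, ∀ t ∈ Finset.Icc 1 T, ∫ x, x.1 ∂(P a t) = r a
  mean_consumption : ∀ a, ∀ t ∈ Finset.Icc 1 T, ∀ i, ∫ x, x.2 i ∂(P a t) = c a i
  null_law : ∀ t ∈ Finset.Icc 1 T, P nullAction t = Measure.dirac 0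

/-- A realized trajectory: action, per-unit reward and per-unit consumptions of every round. -/
structure Trajectory (𝒜 : Type*) (d : ℕ) where
  A : ℕ → 𝒜
  R : ℕ → ℝ
  C : ℕ → Fin d → ℝ

/-- The demand volumes observed before round `t` are `(q 1, …, q (t - 1))`; an oracle turns them
into a prediction of the total demand. -/
abbrev Oracle : Type := (t : ℕ) → (Fin (t - 1) → ℝ) → ℝ

variable {𝒜 : Type*} {d : ℕ}

namespace Instance

/-- The budget `B = b T` of every resource. -/
def B (I : Instance 𝒜 d) : ℝ := I.b * I.T

/-- The total demand `Q = q 1 + ⋯ + q T`. -/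
def Q (I : Instance 𝒜 d) : ℝ := ∑ t ∈ Finset.Icc 1 I.T, I.q t

/-- The feasible set of the linear program. -/
def lpFeasible [Fintype 𝒜] (I : Instance 𝒜 d) : Set (𝒜 → ℝ) :=
  {u | u ∈ stdSimplex ℝ 𝒜 ∧ ∀ i, I.Q * ∑ a, I.c a i * u a ≤ I.B}

/-- The optimal value of the linear program (it is attained, see `isGreatest_optLP`). -/
def optLP [Fintype 𝒜] (I : Instance 𝒜 d) : ℝ :=
  sSup ((fun u : 𝒜 → ℝ => I.Q * ∑ a, I.r a * u a) '' I.lpFeasible)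

/-- The oracle maps histories in `[qlo, qhi]^(t-1)` to predictions in `[qlo T, qhi T]`. -/
def IsOracle (I : Instance 𝒜 d) (F : Oracle) : Prop :=
  ∀ t ∈ Finset.Icc 1 I.T, ∀ x : Fin (t - 1) → ℝ, (∀ s, x s ∈ Set.Icc I.qlo I.qhi) →
    F t x ∈ Set.Icc (I.qlo * I.T) (I.qhi * I.T)

/-- The prediction `F_t(q 1, …, q (t - 1))` received in round `t`. -/
def pred (I : Instance 𝒜 d) (F : Oracle) (t : ℕ) : ℝ :=
  F t (fun s => I.q (s + 1))

/-- The stopping time `τ`: the first round in which some resource is overdrawn, `T + 1` if there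
is none. -/
def stopTime (I : Instance 𝒜 d) (h : Trajectory 𝒜 d) : ℕ :=
  sInf (insert (I.T + 1)
    {t | t ∈ Finset.Icc 1 I.T ∧ ∃ i, I.B < ∑ s ∈ Finset.Icc 1 t, I.q s * h.C s i})

end Instance

/-! ### Confidence bounds -/

/-- The confidence radius. -/
def rad (v N δ : ℝ) : ℝ :=
  √(2 * v * Real.log (1 / δ) / N) + 4 * Real.log (1 / δ) / N

namespace Trajectory

/-- The number of pulls of `a` before round `t`, replaced by `1` if there is none. -/
def pulls [DecidableEq 𝒜] (h : Trajectory 𝒜 d) (t : ℕ) (a : 𝒜) : ℕ :=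
  max ((Finset.Ico 1 t).filter (fun s => h.A s = a)).card 1

/-- Sample mean of the rewards of `a` before round `t`. -/
def meanR [DecidableEq 𝒜] (h : Trajectory 𝒜 d) (t : ℕ) (a : 𝒜) : ℝ :=
  (∑ s ∈ Finset.Ico 1 t, if h.A s = a then h.R s else 0) / h.pulls t a

/-- Sample mean of the consumptions of resource `i` by `a` before round `t`. -/
def meanC [DecidableEq 𝒜] (h : Trajectory 𝒜 d) (t : ℕ) (a : 𝒜) (i : Fin d) : ℝ :=
  (∑ s ∈ Finset.Ico 1 t, if h.A s = a then h.C s i else 0) / h.pulls t a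

/-- Upper confidence bound for the mean reward of `a` at round `t`. -/
def ucb [DecidableEq 𝒜] (h : Trajectory 𝒜 d) (δ : ℝ) (t : ℕ) (a : 𝒜) : ℝ :=
  min (h.meanR t a + rad (h.meanR t a) (h.pulls t a) δ) 1

/-- Lower confidence bounds for the mean consumptions of `a` at round `t`; the last coordinate
belongs to the null resource. -/
def lcb [DecidableEq 𝒜] (h : Trajectory 𝒜 d) (δ : ℝ) (t : ℕ) (a : 𝒜) : Fin (d + 1) → ℝ :=
  Fin.snoc (α := fun _ => ℝ)
    (fun i => max (h.meanC t a i - rad (h.meanC t a i) (h.pulls t a) δ) 0) 0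

end Trajectory

/-! ### AdaHedge on the simplex with `d + 1` vertices, for cost vectors `g 1, g 2, …` -/

/-- `θ_t`, with `θ_1 = 0` and `θ_(t+1) = θ_t - g_t`. -/
def theta (g : ℕ → Fin (d + 1) → ℝ) : ℕ → Fin (d + 1) → ℝ
  | 0 => 0
  | 1 => 0
  | t + 2 => theta g (t + 1) - g (t + 1)

/-- The weights `μ_t` determined by `η_t` and `θ_t`; `μ_1` is uniform. -/
def weights (g : ℕ → Fin (d + 1) → ℝ) (η : ℝ) (t : ℕ) (j : Fin (d + 1)) : ℝ :=
  if t ≤ 1 then 1 / ((d : ℝ) + 1)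
  else Real.exp (theta g t j / η) / ∑ i, Real.exp (theta g t i / η)

/-- The increment `ρ_t` as a function of `η_t`. -/
def rho (g : ℕ → Fin (d + 1) → ℝ) (η : ℝ) (t : ℕ) : ℝ :=
  if t = 1 then ∑ j, g 1 j * weights g η 1 j - ⨅ j, g 1 j
  else η * Real.log (∑ j, weights g η t j * Real.exp (-g t j / η)) +
    ∑ j, g t j * weights g η t j

/-- `η_t`, with `η_1 = 0` and `η_(t+1) = η_t + ρ_t / κ²`, where `κ² = ln (d + 1)`. -/
def eta (g : ℕ → Fin (d + 1) → ℝ) : ℕ → ℝ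
  | 0 => 0
  | 1 => 0
  | t + 2 => eta g (t + 1) + rho g (eta g (t + 1)) (t + 1) / Real.log ((d : ℝ) + 1)

/-! ### The algorithm -/

/-- The vector `β = (1, …, 1, 0)`. -/
def beta : Fin (d + 1) → ℝ := Fin.snoc (α := fun _ => ℝ) (fun _ : Fin d => 1) 0

/-- The cost vector `g_t` passed to AdaHedge in round `t`. -/
def cost [DecidableEq 𝒜] (I : Instance 𝒜 d) (F : Oracle) (δ : ℝ) (h : Trajectory 𝒜 d)
    (t : ℕ) (j : Fin (d + 1)) : ℝ :=
  I.q t * I.pred F t / I.B * (I.B / I.pred F t * beta j - h.lcb δ t (h.A t) j)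

/-- The scalarization `μ_t` used in round `t`; it depends on rounds before `t` only. -/
def scalarization [DecidableEq 𝒜] (I : Instance 𝒜 d) (F : Oracle) (δ : ℝ)
    (h : Trajectory 𝒜 d) (t : ℕ) : Fin (d + 1) → ℝ :=
  weights (cost I F δ h) (eta (cost I F δ h) t) t

/-- The composite reward that the algorithm maximizes over `a` in round `t`. -/
def score [DecidableEq 𝒜] (I : Instance 𝒜 d) (F : Oracle) (δ : ℝ) (h : Trajectory 𝒜 d)
    (t : ℕ) (a : 𝒜) : ℝ :=
  h.ucb δ t a - I.pred F t / I.B * ∑ j, scalarization I F δ h t j * h.lcb δ t a j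

/-- The trajectory is one of OA-UCB with confidence parameter `δ` and oracle `F`: up to the round
in which a resource is overdrawn every action maximizes the composite reward (ties broken in any
way), afterwards the null action is pulled. -/
def FollowsOAUCB [DecidableEq 𝒜] (I : Instance 𝒜 d) (F : Oracle) (δ : ℝ)
    (h : Trajectory 𝒜 d) : Prop :=
  ∀ t ∈ Finset.Icc 1 I.T,
    (t ≤ I.stopTime h → ∀ a, score I F δ h t a ≤ score I F δ h t (h.A t)) ∧
    (I.stopTime h < t → h.A t = I.nullAction)

/-- `H` is a random trajectory generated by a non-anticipating decision maker: `ℱ t` is the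
information after round `t` (it may contain external randomness), `A_t` is chosen on the basis of
`ℱ (t - 1)`, and given `ℱ (t - 1)` the outcome of round `t` has law `P (A_t) t`. -/
structure IsInteraction {Ω : Type*} {mΩ : MeasurableSpace Ω} (I : Instance 𝒜 d)
    (Pr : Measure Ω) (ℱ : Filtration ℕ mΩ) (H : Ω → Trajectory 𝒜 d) : Prop where
  action : ∀ t ∈ Finset.Icc 1 I.T, ∀ a, MeasurableSet[ℱ (t - 1)] {ω | (H ω).A t = a}
  outcome : ∀ t ∈ Finset.Icc 1 I.T, Measurable[ℱ t] (fun ω => ((H ω).R t, (H ω).C t))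
  law : ∀ t ∈ Finset.Icc 1 I.T, ∀ S : Set (ℝ × (Fin d → ℝ)), MeasurableSet S →
    Pr[Set.indicator {ω | ((H ω).R t, (H ω).C t) ∈ S} (fun _ => (1 : ℝ)) | ℱ (t - 1)]
      =ᵐ[Pr] fun ω => (I.P ((H ω).A t) t).real S

/-- The maximum in the linear program is attained. -/
theorem isGreatest_optLP [Fintype 𝒜] (I : Instance 𝒜 d) :
    IsGreatest ((fun u : 𝒜 → ℝ => I.Q * ∑ a, I.r a * u a) '' I.lpFeasible) I.optLP := by
  classical
  have hT : 1 ∈ Finset.Icc 1 I.T := Finset.mem_Icc.2 ⟨le_rfl, I.one_le_T⟩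
  have hc : ∀ i, I.c I.nullAction i = 0 := fun i => by
    rw [← I.mean_consumption _ 1 hT i, I.null_law 1 hT]
    simp
  have hB : 0 ≤ I.B := mul_nonneg I.b_pos.le (Nat.cast_nonneg _)
  refine IsCompact.isGreatest_sSup (IsCompact.image ?_ (by fun_prop)) (Set.Nonempty.image _ ?_)
  · have h : I.lpFeasible =
        stdSimplex ℝ 𝒜 ∩ {u | ∀ i, I.Q * ∑ a, I.c a i * u a ≤ I.B} := rfl
    rw [h]
    refine (isCompact_stdSimplex ℝ 𝒜).inter_right ?_
    simp only [Set.ofPred_forall]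
    exact isClosed_iInter fun i => isClosed_le (by fun_prop) continuous_const
  · refine ⟨Pi.single I.nullAction 1, single_mem_stdSimplex ℝ _, fun i => ?_⟩
    simp [Pi.single_apply, hc, hB]

end OAUCB

end

namespace OAUCB

/-! ### Elementary bounds for the exponential function -/

/-! The played action maximizes the composite reward, so it does at least as well as the optimal LP
mixture. Valid confidence bounds and the LP constraints give, for every round up to the stopping
time, q_t OPT/Q ≤ q_t UCB_t(A_t) + ⟨g_t, μ_t⟩ + q_t ε_t/Q (`round_bound`). Summed over t < τ, the
middle terms are the loss of AdaHedge, which is at most the loss of any fixed vertex plus its regret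
(`adaHedge_regret`, `cost_regret`).

The comparator is chosen in `le_sum_ucb`. If no resource is overdrawn, then τ - 1 = T and the null
vertex, of cost 0, suffices. If resource i is overdrawn, it gets weight w = OPT/Q and the null
vertex gets 1 - w. The cost of i is about the elapsed demand minus Q/B times its optimistic
consumption. That consumption is nearly B (`le_sum_lcb`), so the elapsed demand cancels and wQ = OPT
remains. Hence the optimistic rewards before τ nearly reach OPT, and `sum_ucb_le` passes to the
collected rewards.

Every probabilistic input comes from one supermartingale. For predictable weights v_s, exp(Σ (v_s
X_s - m(A_s)(e^{v_s} - 1))) has mean at most 1, and Markov's inequality gives tails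
(`IsCoordinate.measureReal_le`). Taking v_s proportional to the indicator of the first n pulls of an
arm controls its sample mean; taking v_s proportional to q_s controls the demand-weighted sums.

Accumulated errors are kept in the multiplicative form γ · mean + (log term)/γ. Write L = log(1/δ).
Since Σ L/N_t ≤ 2KL² along the played actions, choosing γ²V = q̄KL² makes all additive errors O(γV),
with V = OPT for rewards and V = B for consumptions. The products γ·OPT are then the two leading
terms of the bound; if one of these γ exceeds 1/4 (or OPT = 0), the bound is trivial. -/

theorem exp_neg_le_quadratic {x : ℝ} (hx : 0 ≤ x) : Real.exp (-x) ≤ 1 - x + x ^ 2 / 2 := by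
  have h := Real.quadratic_le_exp_of_nonneg hx
  rw [Real.exp_neg]
  refine inv_le_of_inv_le₀ (by nlinarith [sq_nonneg (x - 1)]) (le_trans ?_ h)
  rw [inv_le_iff_one_le_mul₀ (by nlinarith [sq_nonneg (x - 1)])]
  -- (1 + x + x²/2)(1 - x + x²/2) = 1 + x⁴/4.
  nlinarith [sq_nonneg (x ^ 2)]

theorem exp_le_one_add_add_sq {x : ℝ} (h0 : 0 ≤ x) (h1 : x ≤ 1) :
    Real.exp x ≤ 1 + x + x ^ 2 := by
  have h := Real.exp_bound' h0 h1 (n := 2) (by norm_num)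
  norm_num [Finset.sum_range_succ] at h
  nlinarith [sq_nonneg x]

/-- From the third term on, the Taylor series is dominated by the geometric series of x²/(2(1 - x)).
This sub-gamma form yields the Bernstein-type bound of `IsCoordinate.arm_upper_tail`. -/
theorem exp_le_sub_gamma {x : ℝ} (h0 : 0 ≤ x) (h1 : x < 1) :
    Real.exp x ≤ 1 + x + x ^ 2 / (2 * (1 - x)) := by
  have h := Real.exp_bound' h0 h1.le (n := 3) (by norm_num)
  norm_num [Finset.sum_range_succ, Nat.factorial] at h
  refine h.trans ?_
  have h2 : 0 < 1 - x := by linarith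
  have : x ^ 2 / (2 * (1 - x)) = x ^ 2 / 2 + x ^ 3 / 2 + x ^ 4 / (2 * (1 - x)) := by
    field_simp; ring
  rw [this]
  have h3 : 0 ≤ x ^ 4 / (2 * (1 - x)) := by positivity
  have h4 : 0 ≤ x ^ 3 := by positivity
  linarith

/-- Convexity on [0, 1]. The right side is affine in x, so its expectation depends on the law only
through the mean; v may have either sign. -/
theorem exp_mul_le_chord {x v : ℝ} (h0 : 0 ≤ x) (h1 : x ≤ 1) :
    Real.exp (v * x) ≤ 1 + x * (Real.exp v - 1) := by
  have h := convexOn_exp.2 (Set.mem_univ 0) (Set.mem_univ v) (by linarith : 0 ≤ 1 - x) h0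
    (by ring)
  simp only [smul_eq_mul, mul_zero, zero_add, Real.exp_zero, mul_one] at h
  rw [mul_comm v x]
  linarith

/-! ### AdaHedge -/

section AdaHedge

variable {d : ℕ}

theorem theta_succ (g : ℕ → Fin (d + 1) → ℝ) {t : ℕ} (ht : 1 ≤ t) :
    theta g (t + 1) = theta g t - g t := by
  obtain ⟨k, rfl⟩ := Nat.exists_eq_add_of_le' ht
  rfl

theorem eta_succ (g : ℕ → Fin (d + 1) → ℝ) {t : ℕ} (ht : 1 ≤ t) :
    eta g (t + 1) = eta g t + rho g (eta g t) t / Real.log ((d : ℝ) + 1) := by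
  obtain ⟨k, rfl⟩ := Nat.exists_eq_add_of_le' ht
  rfl

theorem theta_eq_neg_sum (g : ℕ → Fin (d + 1) → ℝ) (n : ℕ) (j : Fin (d + 1)) :
    theta g (n + 1) j = -∑ t ∈ Finset.Icc 1 n, g t j := by
  induction n with
  | zero => simp [theta]
  | succ n ih =>
    rw [theta_succ g (Nat.succ_pos n), Finset.sum_Icc_succ_top (by omega), Pi.sub_apply, ih]
    ring

theorem weights_nonneg (g : ℕ → Fin (d + 1) → ℝ) (η : ℝ) (t : ℕ) (j : Fin (d + 1)) :
    0 ≤ weights g η t j := by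
  unfold weights
  split_ifs <;> positivity

theorem sum_weights (g : ℕ → Fin (d + 1) → ℝ) (η : ℝ) (t : ℕ) :
    ∑ j, weights g η t j = 1 := by
  unfold weights
  split_ifs
  · simp only [Finset.sum_const, Finset.card_univ, Fintype.card_fin, nsmul_eq_mul]
    push_cast
    field_simp
  · rw [← Finset.sum_div]
    exact div_self (Finset.sum_pos (fun i _ => Real.exp_pos _) Finset.univ_nonempty).ne'

/-- The mixability gap of a probability vector `p` is nonnegative. -/
theorem mixability_gap_nonneg {ι : Type*} [Fintype ι] {p g : ι → ℝ} {η : ℝ} (hη : 0 < η)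
    (hp : ∀ j, 0 ≤ p j) (hp1 : ∑ j, p j = 1) :
    0 ≤ η * Real.log (∑ j, p j * Real.exp (-g j / η)) + ∑ j, g j * p j := by
  have h := convexOn_exp.map_sum_le (t := Finset.univ) (w := p) (p := fun j => -g j / η)
    (fun i _ => hp i) hp1 (fun i _ => Set.mem_univ _)
  simp only [smul_eq_mul] at h
  have h2 := (Real.le_log_iff_exp_le (lt_of_lt_of_le (Real.exp_pos _) h)).2 h
  have h3 := mul_le_mul_of_nonneg_left h2 hη.le
  have h4 : η * ∑ j, p j * (-g j / η) = -∑ j, g j * p j := by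
    rw [Finset.mul_sum, ← Finset.sum_neg_distrib]
    refine Finset.sum_congr rfl fun j _ => ?_
    field_simp
  linarith

theorem sum_mul_exp_pos {ι : Type*} [Fintype ι] {p g : ι → ℝ} (hp : ∀ j, 0 ≤ p j)
    (hp1 : ∑ j, p j = 1) : 0 < ∑ j, p j * Real.exp (g j) := by
  refine (Finset.sum_nonneg fun j _ => mul_nonneg (hp j) (Real.exp_pos _).le).lt_of_ne' ?_
  intro h
  rw [Finset.sum_eq_zero_iff_of_nonneg fun j _ => mul_nonneg (hp j) (Real.exp_pos _).le] at h
  have : ∑ j, p j = 0 := Finset.sum_eq_zero fun j hj => by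
    simpa [(Real.exp_pos _).ne'] using h j hj
  linarith

theorem mixability_gap_le_range {ι : Type*} [Fintype ι] {p g : ι → ℝ} {η lo G : ℝ} (hη : 0 < η)
    (hp : ∀ j, 0 ≤ p j) (hp1 : ∑ j, p j = 1) (hlo : ∀ j, lo ≤ g j) (hhi : ∀ j, g j ≤ lo + G) :
    η * Real.log (∑ j, p j * Real.exp (-g j / η)) + ∑ j, g j * p j ≤ G := by
  have h1 : ∑ j, p j * Real.exp (-g j / η) ≤ Real.exp (-lo / η) := by
    calc _ ≤ ∑ j, p j * Real.exp (-lo / η) := by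
          refine Finset.sum_le_sum fun j _ => mul_le_mul_of_nonneg_left ?_ (hp j)
          have := hlo j
          gcongr
      _ = _ := by rw [← Finset.sum_mul, hp1, one_mul]
  have h2 : Real.log (∑ j, p j * Real.exp (-g j / η)) ≤ -lo / η := by
    rw [← Real.log_exp (-lo / η)]
    exact Real.log_le_log (sum_mul_exp_pos hp hp1) h1
  have h3 : ∑ j, g j * p j ≤ lo + G := by
    calc _ ≤ ∑ j, (lo + G) * p j :=
          Finset.sum_le_sum fun j _ => mul_le_mul_of_nonneg_right (hhi j) (hp j)
      _ = _ := by rw [← Finset.mul_sum, hp1, mul_one]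
  have h4 := mul_le_mul_of_nonneg_left h2 hη.le
  have h5 : η * (-lo / η) = -lo := by field_simp
  linarith

/-- After the substitution g = lo + ηy, the linear terms cancel in e^{-y} ≤ 1 - y + y²/2 followed by
1 + z ≤ e^z. What is left is the quadratic term with y ≤ G/η. -/
theorem mixability_gap_le_sq {ι : Type*} [Fintype ι] {p g : ι → ℝ} {η lo G : ℝ} (hη : 0 < η)
    (hp : ∀ j, 0 ≤ p j) (hp1 : ∑ j, p j = 1) (hlo : ∀ j, lo ≤ g j) (hhi : ∀ j, g j ≤ lo + G) :
    η * (η * Real.log (∑ j, p j * Real.exp (-g j / η)) + ∑ j, g j * p j) ≤ G ^ 2 / 2 := by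
  set y : ι → ℝ := fun j => (g j - lo) / η with hy
  have hy0 : ∀ j, 0 ≤ y j := fun j => div_nonneg (by linarith [hlo j]) hη.le
  have hyG : ∀ j, y j ≤ G / η := fun j => by
    have := hhi j
    simp only [hy]
    gcongr
    linarith
  have hgy : ∀ j, g j = lo + η * y j := fun j => by simp only [hy]; field_simp; ring
  have h1 : ∑ j, p j * Real.exp (-g j / η) = Real.exp (-lo / η) * ∑ j, p j * Real.exp (-y j) := by
    rw [Finset.mul_sum]
    refine Finset.sum_congr rfl fun j _ => ?_
    rw [mul_left_comm, ← Real.exp_add]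
    congr 2
    simp only [hy]
    ring
  have h2 : ∑ j, p j * Real.exp (-y j) ≤ Real.exp (-(∑ j, p j * y j) + (G / η) ^ 2 / 2) := by
    calc _ ≤ ∑ j, p j * (1 - y j + (G / η) ^ 2 / 2) := by
          refine Finset.sum_le_sum fun j _ => mul_le_mul_of_nonneg_left ?_ (hp j)
          have := exp_neg_le_quadratic (hy0 j)
          have h3 : y j ^ 2 ≤ (G / η) ^ 2 := by
            have := hyG j
            have := hy0 j
            gcongr
          linarith
      _ = 1 + (-(∑ j, p j * y j) + (G / η) ^ 2 / 2) := by
          have : ∀ j, p j * (1 - y j + (G / η) ^ 2 / 2) =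
              p j * (1 + (G / η) ^ 2 / 2) - p j * y j := fun j => by ring
          simp only [this, Finset.sum_sub_distrib, ← Finset.sum_mul, hp1]
          ring
      _ ≤ _ := by linarith [Real.add_one_le_exp (-(∑ j, p j * y j) + (G / η) ^ 2 / 2)]
  have hpos : 0 < ∑ j, p j * Real.exp (-y j) := sum_mul_exp_pos hp hp1
  have h3 : Real.log (∑ j, p j * Real.exp (-g j / η)) ≤
      -lo / η + (-(∑ j, p j * y j) + (G / η) ^ 2 / 2) := by
    rw [h1, Real.log_mul (Real.exp_pos _).ne' hpos.ne', Real.log_exp]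
    gcongr
    rw [Real.log_le_iff_le_exp hpos]
    exact h2
  have h4 : ∑ j, g j * p j = lo + η * ∑ j, p j * y j := by
    have : ∀ j, g j * p j = lo * p j + η * (p j * y j) := fun j => by
      rw [hgy j]; ring
    simp only [this, Finset.sum_add_distrib, ← Finset.mul_sum, hp1, mul_one]
  rw [h4]
  calc _ ≤ η * (η * (-lo / η + (-(∑ j, p j * y j) + (G / η) ^ 2 / 2)) +
        (lo + η * ∑ j, p j * y j)) := by gcongr
    _ = _ := by field_simp; ring

/-- The log-partition function `η ln (mean of e^{θ_j / η})`. -/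
noncomputable def logPartition (θ : Fin (d + 1) → ℝ) (η : ℝ) : ℝ :=
  η * Real.log (∑ j, ((d : ℝ) + 1)⁻¹ * Real.exp (θ j / η))

theorem sum_uniform (d : ℕ) : ∑ _j : Fin (d + 1), ((d : ℝ) + 1)⁻¹ = 1 := by
  simp only [Finset.sum_const, Finset.card_univ, Fintype.card_fin, nsmul_eq_mul]
  push_cast
  field_simp

theorem uniform_nonneg (d : ℕ) : 0 ≤ ((d : ℝ) + 1)⁻¹ := by positivity

/-- This is the logarithm of the L^{1/η} norm of e^θ under the uniform probability, and L^p norms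
increase with p. -/
theorem logPartition_antitone (θ : Fin (d + 1) → ℝ) {η η' : ℝ} (hη : 0 < η) (h : η ≤ η') :
    logPartition θ η' ≤ logPartition θ η := by
  have hη' : 0 < η' := hη.trans_le h
  have h1 := Real.rpow_arith_mean_le_arith_mean_rpow Finset.univ
    (fun _ : Fin (d + 1) => ((d : ℝ) + 1)⁻¹) (fun j => Real.exp (θ j / η'))
    (fun _ _ => uniform_nonneg d) (sum_uniform d) (fun _ _ => (Real.exp_pos _).le)
    (p := η' / η) ((one_le_div hη).2 h)
  have h2 : ∀ j, Real.exp (θ j / η') ^ (η' / η) = Real.exp (θ j / η) := fun j => by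
    rw [← Real.exp_mul]
    congr 1
    field_simp
  simp only [h2] at h1
  have hpos : 0 < ∑ j, ((d : ℝ) + 1)⁻¹ * Real.exp (θ j / η') :=
    sum_mul_exp_pos (p := fun _ => ((d : ℝ) + 1)⁻¹) (fun _ => uniform_nonneg d) (sum_uniform d)
  have h3 := Real.log_le_log (Real.rpow_pos_of_pos hpos _) h1
  rw [Real.log_rpow hpos] at h3
  unfold logPartition
  have h4 := mul_le_mul_of_nonneg_left h3 hη.le
  refine le_trans (le_of_eq ?_) h4
  field_simp

theorem logPartition_le (θ : Fin (d + 1) → ℝ) {η m : ℝ} (hη : 0 < η) (h : ∀ j, θ j ≤ m) :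
    logPartition θ η ≤ m := by
  have hpos : 0 < ∑ j, ((d : ℝ) + 1)⁻¹ * Real.exp (θ j / η) :=
    sum_mul_exp_pos (p := fun _ => ((d : ℝ) + 1)⁻¹) (fun _ => uniform_nonneg d) (sum_uniform d)
  have h1 : Real.log (∑ j, ((d : ℝ) + 1)⁻¹ * Real.exp (θ j / η)) ≤ m / η := by
    rw [Real.log_le_iff_le_exp hpos]
    calc _ ≤ ∑ _j : Fin (d + 1), ((d : ℝ) + 1)⁻¹ * Real.exp (m / η) := by
          refine Finset.sum_le_sum fun j _ => ?_
          have := h j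
          gcongr
      _ = _ := by rw [← Finset.sum_mul, sum_uniform, one_mul]
  unfold logPartition
  calc _ ≤ η * (m / η) := by gcongr
    _ = m := by field_simp

theorem le_logPartition (θ : Fin (d + 1) → ℝ) {η : ℝ} (hη : 0 < η) (j : Fin (d + 1)) :
    θ j - η * Real.log ((d : ℝ) + 1) ≤ logPartition θ η := by
  have hd : (0 : ℝ) < (d : ℝ) + 1 := by positivity
  have h1 : ((d : ℝ) + 1)⁻¹ * Real.exp (θ j / η) ≤
      ∑ j, ((d : ℝ) + 1)⁻¹ * Real.exp (θ j / η) :=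
    Finset.single_le_sum (f := fun j => ((d : ℝ) + 1)⁻¹ * Real.exp (θ j / η))
      (fun i _ => by positivity) (Finset.mem_univ j)
  have h2 := Real.log_le_log (by positivity) h1
  rw [Real.log_mul (by positivity) (Real.exp_pos _).ne', Real.log_exp, Real.log_inv] at h2
  unfold logPartition
  have h3 := mul_le_mul_of_nonneg_left h2 hη.le
  refine le_trans (le_of_eq ?_) h3
  field_simp
  ring

/-- The mix loss of round `t` is an increment of the log-partition function. -/
theorem mixLoss_eq (g : ℕ → Fin (d + 1) → ℝ) {η : ℝ} {t : ℕ} (ht : 2 ≤ t) :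
    η * Real.log (∑ j, weights g η t j * Real.exp (-g t j / η)) =
      logPartition (theta g (t + 1)) η - logPartition (theta g t) η := by
  have hS : 0 < ∑ i, Real.exp (theta g t i / η) :=
    Finset.sum_pos (fun i _ => Real.exp_pos _) Finset.univ_nonempty
  have hS' : 0 < ∑ i, Real.exp (theta g (t + 1) i / η) :=
    Finset.sum_pos (fun i _ => Real.exp_pos _) Finset.univ_nonempty
  have hd : ((d : ℝ) + 1)⁻¹ ≠ 0 := by positivity
  have h1 : ∑ j, weights g η t j * Real.exp (-g t j / η) =
      (∑ i, Real.exp (theta g (t + 1) i / η)) / ∑ i, Real.exp (theta g t i / η) := by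
    rw [Finset.sum_div]
    refine Finset.sum_congr rfl fun j _ => ?_
    rw [weights, if_neg (by omega), div_mul_eq_mul_div, ← Real.exp_add, theta_succ g (by omega),
      Pi.sub_apply]
    congr 2
    ring
  unfold logPartition
  rw [h1, Real.log_div hS'.ne' hS.ne', ← Finset.mul_sum, ← Finset.mul_sum,
    Real.log_mul hd hS'.ne', Real.log_mul hd hS.ne']
  ring

variable {g : ℕ → Fin (d + 1) → ℝ}

theorem rho_nonneg {η : ℝ} {t : ℕ} (ht : 2 ≤ t) (hη : 0 < η) : 0 ≤ rho g η t := by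
  rw [rho, if_neg (by omega)]
  exact mixability_gap_nonneg hη (weights_nonneg g η t) (sum_weights g η t)

theorem log_succ_pos (hd : 1 ≤ d) : 0 < Real.log ((d : ℝ) + 1) :=
  Real.log_pos (by have : (1 : ℝ) ≤ d := by exact_mod_cast hd
                   linarith)

theorem eta_pos (hd : 1 ≤ d) (h1 : 0 < rho g 0 1) (n : ℕ) : 0 < eta g (n + 2) := by
  induction n with
  | zero =>
    rw [eta_succ g le_rfl]
    simpa [eta] using div_pos h1 (log_succ_pos hd)
  | succ n ih =>
    rw [eta_succ g (by omega)]
    have := div_nonneg (rho_nonneg (g := g) (t := n + 2) (by omega) ih) (log_succ_pos hd).le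
    linarith

theorem eta_mono (hd : 1 ≤ d) (h1 : 0 < rho g 0 1) (n : ℕ) : eta g (n + 2) ≤ eta g (n + 3) := by
  rw [eta_succ g (t := n + 2) (by omega)]
  have := div_nonneg (rho_nonneg (g := g) (t := n + 2) (by omega) (eta_pos hd h1 n))
    (log_succ_pos hd).le
  linarith

/-- The loss of a round is its gap ρ minus its mix loss. Mix losses telescope as increments of the
log-partition function, because raising η between rounds can only lower that function; the gaps add
up to ln(d + 1) · η. -/
theorem sum_loss_le_logPartition (hd : 1 ≤ d) (h1 : 0 < rho g 0 1) (n : ℕ) :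
    ∑ t ∈ Finset.Icc 1 (n + 1), ∑ j, g t j * weights g (eta g t) t j ≤
      -logPartition (theta g (n + 2)) (eta g (n + 2)) +
        Real.log ((d : ℝ) + 1) * eta g (n + 2) := by
  have hl := log_succ_pos hd
  induction n with
  | zero =>
    have h2 : Real.log ((d : ℝ) + 1) * eta g 2 = rho g 0 1 := by
      rw [eta_succ g le_rfl]
      simp only [eta, zero_add]
      field_simp
    -- Round 1 has η = 0, where the minimum of the costs takes the place of the mix loss.
    have h3 : logPartition (theta g 2) (eta g 2) ≤ -⨅ j, g 1 j := by
      refine logPartition_le _ (eta_pos hd h1 0) fun j => ?_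
      rw [theta_succ g le_rfl]
      simp only [theta, zero_sub, Pi.neg_apply]
      exact neg_le_neg (ciInf_le (Set.finite_range _).bddBelow j)
    simp only [zero_add, Finset.Icc_self, Finset.sum_singleton]
    rw [h2, rho, if_pos rfl]
    have : eta g 1 = 0 := rfl
    rw [this]
    linarith
  | succ n ih =>
    rw [Finset.sum_Icc_succ_top (by omega)]
    have h2 : Real.log ((d : ℝ) + 1) * eta g (n + 3) =
        Real.log ((d : ℝ) + 1) * eta g (n + 2) + rho g (eta g (n + 2)) (n + 2) := by
      rw [eta_succ g (t := n + 2) (by omega)]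
      field_simp
    have h3 := logPartition_antitone (theta g (n + 3)) (eta_pos hd h1 n) (eta_mono hd h1 n)
    have h4 := mixLoss_eq g (η := eta g (n + 2)) (t := n + 2) (by omega)
    rw [rho, if_neg (by omega)] at h2
    change _ ≤ -logPartition (theta g (n + 3)) (eta g (n + 3)) + _ * eta g (n + 3)
    change _ + ∑ j, g (n + 2) j * weights g (eta g (n + 2)) (n + 2) j ≤ _
    change _ = logPartition (theta g (n + 3)) _ - _ at h4
    linarith

/-- Regret bound in terms of the final inverse learning rate. -/
theorem sum_loss_le (hd : 1 ≤ d) (h1 : 0 < rho g 0 1) (n : ℕ) (j : Fin (d + 1)) :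
    ∑ t ∈ Finset.Icc 1 (n + 1), ∑ j, g t j * weights g (eta g t) t j ≤
      ∑ t ∈ Finset.Icc 1 (n + 1), g t j + 2 * (Real.log ((d : ℝ) + 1) * eta g (n + 2)) := by
  have h2 := sum_loss_le_logPartition hd h1 n
  have h3 := le_logPartition (theta g (n + 2)) (eta_pos hd h1 n) j
  rw [theta_eq_neg_sum] at h3
  linarith

/-- Put κ² = ln(d + 1) and X = κ²η. Then X_{t+1}² = X_t² + 2X_tρ_t + ρ_t², where ηρ ≤ G²/2 and ρ ≤
G, so each round adds at most G²(κ² + 1). -/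
theorem sq_log_mul_eta_le (hd : 1 ≤ d) (h1 : 0 < rho g 0 1) {lo : ℕ → ℝ} {G : ℝ} (n : ℕ)
    (hlo : ∀ t ∈ Finset.Icc 1 (n + 1), ∀ j, lo t ≤ g t j)
    (hhi : ∀ t ∈ Finset.Icc 1 (n + 1), ∀ j, g t j ≤ lo t + G) :
    (Real.log ((d : ℝ) + 1) * eta g (n + 2)) ^ 2 ≤
      (n + 1) * (G ^ 2 * (Real.log ((d : ℝ) + 1) + 1)) := by
  have hl := log_succ_pos hd
  induction n with
  | zero =>
    have h2 : Real.log ((d : ℝ) + 1) * eta g 2 = rho g 0 1 := by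
      rw [eta_succ g le_rfl]
      simp only [eta, zero_add]
      field_simp
    have h3 : rho g 0 1 ≤ G := by
      rw [rho, if_pos rfl]
      have h4 : lo 1 ≤ ⨅ j, g 1 j := le_ciInf fun j => hlo 1 (by simp) j
      have h5 : ∑ j, g 1 j * weights g 0 1 j ≤ lo 1 + G := by
        calc _ ≤ ∑ j, (lo 1 + G) * weights g 0 1 j := Finset.sum_le_sum fun j _ =>
              mul_le_mul_of_nonneg_right (hhi 1 (by simp) j) (weights_nonneg _ _ _ _)
          _ = _ := by rw [← Finset.mul_sum, sum_weights, mul_one]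
      linarith
    change (Real.log ((d : ℝ) + 1) * eta g 2) ^ 2 ≤ _
    rw [h2]
    have h4 : rho g 0 1 ^ 2 ≤ G ^ 2 := by gcongr
    push_cast
    nlinarith [mul_nonneg (sq_nonneg G) hl.le]
  | succ n ih =>
    have ih := ih (fun t ht => hlo t (Finset.Icc_subset_Icc_right (by omega) ht))
      (fun t ht => hhi t (Finset.Icc_subset_Icc_right (by omega) ht))
    have h2 : Real.log ((d : ℝ) + 1) * eta g (n + 3) =
        Real.log ((d : ℝ) + 1) * eta g (n + 2) + rho g (eta g (n + 2)) (n + 2) := by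
      rw [eta_succ g (t := n + 2) (by omega)]
      field_simp
    have hη := eta_pos hd h1 n
    have hm : n + 2 ∈ Finset.Icc 1 (n + 1 + 1) := by simp
    have h3 : rho g (eta g (n + 2)) (n + 2) ≤ G := by
      rw [rho, if_neg (by omega)]
      exact mixability_gap_le_range hη (weights_nonneg _ _ _) (sum_weights _ _ _) (hlo _ hm)
        (hhi _ hm)
    have h4 : eta g (n + 2) * rho g (eta g (n + 2)) (n + 2) ≤ G ^ 2 / 2 := by
      rw [rho, if_neg (by omega)]
      exact mixability_gap_le_sq hη (weights_nonneg _ _ _) (sum_weights _ _ _) (hlo _ hm)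
        (hhi _ hm)
    have h5 := rho_nonneg (g := g) (t := n + 2) (by omega) hη
    change (Real.log ((d : ℝ) + 1) * eta g (n + 3)) ^ 2 ≤ _
    rw [h2]
    have h6 : rho g (eta g (n + 2)) (n + 2) ^ 2 ≤ G ^ 2 := by gcongr
    have h7 := mul_le_mul_of_nonneg_left h4 hl.le
    push_cast
    nlinarith

/-- AdaHedge has regret at most `4 G √(n ln (d + 1))` if the cost vectors have range at
most `G`. -/
theorem adaHedge_regret (hd : 1 ≤ d) (h1 : 0 < rho g 0 1) {lo : ℕ → ℝ} {G : ℝ} (hG : 0 ≤ G)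
    (n : ℕ) (hlo : ∀ t ∈ Finset.Icc 1 n, ∀ j, lo t ≤ g t j)
    (hhi : ∀ t ∈ Finset.Icc 1 n, ∀ j, g t j ≤ lo t + G) (j : Fin (d + 1)) :
    ∑ t ∈ Finset.Icc 1 n, ∑ j, g t j * weights g (eta g t) t j ≤
      ∑ t ∈ Finset.Icc 1 n, g t j + 4 * (G * √(n * Real.log ((d : ℝ) + 1))) := by
  cases n with
  | zero => simp
  | succ n =>
    have hl := log_succ_pos hd
    have h2 := sum_loss_le hd h1 n j
    have h3 := sq_log_mul_eta_le hd h1 n hlo hhi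
    -- Since d ≥ 1, ln(d + 1) ≥ ln 2 > 1/3, which absorbs the additive 1 of the previous bound: κ² +
    -- 1 ≤ 4κ².
    have h4 : (1 : ℝ) ≤ 3 * Real.log ((d : ℝ) + 1) := by
      have : Real.log 2 ≤ Real.log ((d : ℝ) + 1) := by
        apply Real.log_le_log (by norm_num)
        have : (1 : ℝ) ≤ d := by exact_mod_cast hd
        linarith
      linarith [Real.log_two_gt_d9]
    have h5 : Real.log ((d : ℝ) + 1) * eta g (n + 2) ≤
        2 * (G * √((n + 1 : ℕ) * Real.log ((d : ℝ) + 1))) := by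
      refine abs_le_of_sq_le_sq' ?_ (by positivity) |>.2
      rw [mul_pow 2, mul_pow G, Real.sq_sqrt (by positivity)]
      push_cast
      refine h3.trans ?_
      have : 0 ≤ ((n : ℝ) + 1) * G ^ 2 := by positivity
      nlinarith
    linarith

end AdaHedge

/-! ### An exponential supermartingale with predictable weights -/

section Concentration

variable {𝒜 : Type*} {d : ℕ} {Ω : Type*} {mΩ : MeasurableSpace Ω} {I : Instance 𝒜 d}
  {Pr : Measure Ω} {ℱ : Filtration ℕ mΩ} {H : Ω → Trajectory 𝒜 d}

theorem IsInteraction.measurable_comp_action [Fintype 𝒜] (hI : IsInteraction I Pr ℱ H) {t : ℕ}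
    (ht : t ∈ Finset.Icc 1 I.T) (f : 𝒜 → ℝ) :
    Measurable[ℱ (t - 1)] fun ω => f ((H ω).A t) := by
  classical
  have : (fun ω => f ((H ω).A t)) =
      fun ω => ∑ a, Set.indicator {ω | (H ω).A t = a} (fun _ => f a) ω := by
    ext ω
    simp [Set.indicator_apply]
  rw [this]
  exact Finset.measurable_sum _ fun a _ => measurable_const.indicator (hI.action t ht a)

theorem IsInteraction.measurable_outcome (hI : IsInteraction I Pr ℱ H) {t : ℕ}
    (ht : t ∈ Finset.Icc 1 I.T) : Measurable fun ω => ((H ω).R t, (H ω).C t) :=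
  (hI.outcome t ht).mono (ℱ.le t) le_rfl

/-- On a past event on which `a` is played, the outcome is distributed according to `P a t`. -/
theorem IsInteraction.map_restrict [IsProbabilityMeasure Pr] (hI : IsInteraction I Pr ℱ H) {t : ℕ}
    (ht : t ∈ Finset.Icc 1 I.T) (a : 𝒜) {D : Set Ω} (hD : MeasurableSet[ℱ (t - 1)] D) :
    (Pr.restrict (D ∩ {ω | (H ω).A t = a})).map (fun ω => ((H ω).R t, (H ω).C t)) =
      Pr (D ∩ {ω | (H ω).A t = a}) • I.P a t := by
  have := I.isProbabilityMeasure a t ht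
  have hX := hI.measurable_outcome ht
  have hD' : MeasurableSet[ℱ (t - 1)] (D ∩ {ω | (H ω).A t = a}) := hD.inter (hI.action t ht a)
  set D' := D ∩ {ω | (H ω).A t = a} with hDdef
  ext S hS
  rw [Measure.map_apply hX hS, Measure.restrict_apply (hX hS), Measure.smul_apply, smul_eq_mul]
  have hm : MeasurableSet {ω | ((H ω).R t, (H ω).C t) ∈ S} := hX hS
  have hint : Integrable (Set.indicator {ω | ((H ω).R t, (H ω).C t) ∈ S} fun _ => (1 : ℝ)) Pr :=
    (integrable_const 1).indicator hm
  have h1 := setIntegral_condExp (ℱ.le (t - 1)) hint hD'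
  have h2 : ∫ ω in D', (Pr[Set.indicator {ω | ((H ω).R t, (H ω).C t) ∈ S}
      (fun _ => (1 : ℝ)) | ℱ (t - 1)]) ω ∂Pr = ∫ _ω in D', (I.P a t).real S ∂Pr := by
    refine setIntegral_congr_ae (ℱ.le _ _ hD') ?_
    filter_upwards [hI.law t ht S hS] with ω hω hωD
    rw [hω, show (H ω).A t = a from hωD.2]
  rw [h2, setIntegral_const, setIntegral_indicator hm, setIntegral_const, smul_eq_mul,
    smul_eq_mul, mul_one] at h1
  have h3 : Pr.real D' * (I.P a t).real S = (Pr D' * I.P a t S).toReal := by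
    rw [ENNReal.toReal_mul]; rfl
  rw [h3] at h1
  have h4 := (ENNReal.toReal_eq_toReal_iff' (ENNReal.mul_ne_top (measure_ne_top _ _)
    (measure_ne_top _ _)) (measure_ne_top Pr _)).1 h1
  rw [h4, Set.inter_comm]
  rfl

/-- Properties that every law `P a t` has almost surely pass to the outcome of round `t`. -/
theorem IsInteraction.ae_outcome [Fintype 𝒜] [IsProbabilityMeasure Pr]
    (hI : IsInteraction I Pr ℱ H) {t : ℕ} (ht : t ∈ Finset.Icc 1 I.T)
    {p : ℝ × (Fin d → ℝ) → Prop} (hp : MeasurableSet {x | p x}) (h : ∀ a, ∀ᵐ x ∂I.P a t, p x) :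
    ∀ᵐ ω ∂Pr, p ((H ω).R t, (H ω).C t) := by
  have h1 : ∀ a, ∀ᵐ ω ∂Pr, (H ω).A t = a → p ((H ω).R t, (H ω).C t) := by
    intro a
    have h2 := hI.map_restrict ht a MeasurableSet.univ
    have h3 : ∀ᵐ x ∂(Pr (Set.univ ∩ {ω | (H ω).A t = a}) • I.P a t), p x :=
      Measure.ae_smul_measure (h a) _
    rw [← h2, ae_map_iff (hI.measurable_outcome ht).aemeasurable hp, Set.univ_inter,
      ae_restrict_iff' (ℱ.le _ _ (hI.action t ht a))] at h3
    exact h3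
  filter_upwards [ae_all_iff.2 h1] with ω hω
  exact hω _ rfl

/-- A coordinate of the outcome with values in `[0, 1]` and time-invariant mean `m a`. -/
structure IsCoordinate (I : Instance 𝒜 d) (φ : ℝ × (Fin d → ℝ) → ℝ) (m : 𝒜 → ℝ) : Prop where
  measurable : Measurable φ
  mem_unit : ∀ a, ∀ t ∈ Finset.Icc 1 I.T, ∀ᵐ x ∂(I.P a t), φ x ∈ Set.Icc (0 : ℝ) 1
  mean : ∀ a, ∀ t ∈ Finset.Icc 1 I.T, ∫ x, φ x ∂(I.P a t) = m a

theorem isCoordinate_reward (I : Instance 𝒜 d) : IsCoordinate I Prod.fst I.r where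
  measurable := measurable_fst
  mem_unit a t ht := (I.mem_unit a t ht).mono fun _ h => h.1
  mean := I.mean_reward

theorem isCoordinate_consumption (I : Instance 𝒜 d) (i : Fin d) :
    IsCoordinate I (fun x => x.2 i) fun a => I.c a i where
  measurable := by fun_prop
  mem_unit a t ht := (I.mem_unit a t ht).mono fun _ h => h.2 i
  mean a t ht := I.mean_consumption a t ht i

variable {φ : ℝ × (Fin d → ℝ) → ℝ} {m : 𝒜 → ℝ}

theorem IsCoordinate.mean_mem (hφ : IsCoordinate I φ m) (a : 𝒜) : m a ∈ Set.Icc (0 : ℝ) 1 := by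
  have hT : 1 ∈ Finset.Icc 1 I.T := Finset.mem_Icc.2 ⟨le_rfl, I.one_le_T⟩
  have := I.isProbabilityMeasure a 1 hT
  have hint : Integrable φ (I.P a 1) := by
    refine Integrable.of_bound hφ.measurable.aestronglyMeasurable 1 ?_
    filter_upwards [hφ.mem_unit a 1 hT] with x hx
    rw [Real.norm_eq_abs, abs_le]
    constructor <;> linarith [hx.1, hx.2]
  rw [← hφ.mean a 1 hT]
  constructor
  · exact integral_nonneg_of_ae ((hφ.mem_unit a 1 hT).mono fun _ h => h.1)
  · have := integral_mono_ae hint (integrable_const 1)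
      ((hφ.mem_unit a 1 hT).mono fun _ h => h.2)
    simpa using this

/-- The value of the coordinate `φ` in round `t`. -/
def obs (φ : ℝ × (Fin d → ℝ) → ℝ) (H : Ω → Trajectory 𝒜 d) (t : ℕ) (ω : Ω) : ℝ :=
  φ ((H ω).R t, (H ω).C t)

theorem IsCoordinate.ae_obs_mem [Fintype 𝒜] [IsProbabilityMeasure Pr] (hφ : IsCoordinate I φ m)
    (hI : IsInteraction I Pr ℱ H) {t : ℕ} (ht : t ∈ Finset.Icc 1 I.T) :
    ∀ᵐ ω ∂Pr, obs φ H t ω ∈ Set.Icc (0 : ℝ) 1 :=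
  hI.ae_outcome ht (p := fun x => φ x ∈ Set.Icc (0 : ℝ) 1) (hφ.measurable measurableSet_Icc)
    fun a => hφ.mem_unit a t ht

theorem IsCoordinate.measurable_obs (hφ : IsCoordinate I φ m)
    (hI : IsInteraction I Pr ℱ H) {t : ℕ} (ht : t ∈ Finset.Icc 1 I.T) :
    Measurable[ℱ t] (obs φ H t) :=
  hφ.measurable.comp (hI.outcome t ht)

theorem IsCoordinate.integrable_obs [Fintype 𝒜] [IsProbabilityMeasure Pr]
    (hφ : IsCoordinate I φ m) (hI : IsInteraction I Pr ℱ H) {t : ℕ}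
    (ht : t ∈ Finset.Icc 1 I.T) : Integrable (obs φ H t) Pr := by
  refine Integrable.of_bound
    ((hφ.measurable_obs hI ht).mono (ℱ.le t) le_rfl).aestronglyMeasurable 1 ?_
  filter_upwards [hφ.ae_obs_mem hI ht] with x hx
  rw [Real.norm_eq_abs, abs_le]
  constructor <;> linarith [hx.1, hx.2]

/-- A past event splits into finitely many pieces according to the action played; on each piece the
outcome has the law of that action, hence its mean. -/
theorem IsCoordinate.condExp_obs [Fintype 𝒜] [IsProbabilityMeasure Pr] (hφ : IsCoordinate I φ m)
    (hI : IsInteraction I Pr ℱ H) {t : ℕ} (ht : t ∈ Finset.Icc 1 I.T) :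
    Pr[obs φ H t | ℱ (t - 1)] =ᵐ[Pr] fun ω => m ((H ω).A t) := by
  have hmeas := hI.measurable_comp_action ht m
  have hint : Integrable (fun ω => m ((H ω).A t)) Pr := by
    refine Integrable.of_bound (hmeas.mono (ℱ.le _) le_rfl).aestronglyMeasurable 1 ?_
    refine Filter.Eventually.of_forall fun ω => ?_
    have := hφ.mean_mem ((H ω).A t)
    rw [Real.norm_eq_abs, abs_le]
    constructor <;> linarith [this.1, this.2]
  refine (ae_eq_condExp_of_forall_setIntegral_eq (ℱ.le _) (hφ.integrable_obs hI ht)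
    (fun _ _ _ => hint.integrableOn) (fun D hD _ => ?_)
    hmeas.stronglyMeasurable.aestronglyMeasurable).symm
  have hsplit : ∀ f : Ω → ℝ, Integrable f Pr →
      ∫ ω in D, f ω ∂Pr = ∑ a, ∫ ω in D ∩ {ω | (H ω).A t = a}, f ω ∂Pr := by
    intro f hf
    rw [← integral_iUnion_fintype (fun a => ℱ.le _ _ (hD.inter (hI.action t ht a))) ?_
      fun a => hf.integrableOn]
    · congr 2
      ext ω
      simp
    · intro a b hab
      refine Set.disjoint_left.2 fun ω h1 h2 => hab ?_
      exact h1.2.symm.trans h2.2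
  rw [hsplit _ hint, hsplit _ (hφ.integrable_obs hI ht)]
  refine Finset.sum_congr rfl fun a _ => ?_
  have h1 : ∫ ω in D ∩ {ω | (H ω).A t = a}, m ((H ω).A t) ∂Pr =
      ∫ _ω in D ∩ {ω | (H ω).A t = a}, m a ∂Pr := by
    refine setIntegral_congr_fun (ℱ.le _ _ (hD.inter (hI.action t ht a))) fun ω hω => ?_
    rw [show (H ω).A t = a from hω.2]
  have h2 : ∫ ω in D ∩ {ω | (H ω).A t = a}, obs φ H t ω ∂Pr =
      ∫ x, φ x ∂((Pr.restrict (D ∩ {ω | (H ω).A t = a})).map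
        fun ω => ((H ω).R t, (H ω).C t)) := by
    rw [integral_map (hI.measurable_outcome ht).aemeasurable
      hφ.measurable.aestronglyMeasurable]
    rfl
  rw [h1, h2, hI.map_restrict ht a hD, integral_smul_measure, hφ.mean a t ht, setIntegral_const]
  rfl

/-- The exponent of the supermartingale for predictable weights `v`. -/
noncomputable def poissonExponent (φ : ℝ × (Fin d → ℝ) → ℝ) (m : 𝒜 → ℝ) (H : Ω → Trajectory 𝒜 d)
    (v : ℕ → Ω → ℝ) (n : ℕ) (ω : Ω) : ℝ :=
  ∑ s ∈ Finset.Icc 1 n, (v s ω * obs φ H s ω - m ((H ω).A s) * (Real.exp (v s ω) - 1))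

theorem poissonExponent_succ (v : ℕ → Ω → ℝ) (n : ℕ) (ω : Ω) :
    poissonExponent φ m H v (n + 1) ω = poissonExponent φ m H v n ω +
      (v (n + 1) ω * obs φ H (n + 1) ω - m ((H ω).A (n + 1)) * (Real.exp (v (n + 1) ω) - 1)) := by
  rw [poissonExponent, Finset.sum_Icc_succ_top (by omega)]
  rfl

theorem IsCoordinate.measurable_poissonExponent [Fintype 𝒜] (hφ : IsCoordinate I φ m)
    (hI : IsInteraction I Pr ℱ H) {v : ℕ → Ω → ℝ}
    (hv : ∀ s ∈ Finset.Icc 1 I.T, Measurable[ℱ (s - 1)] (v s)) {n : ℕ} (hn : n ≤ I.T) :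
    Measurable[ℱ n] (poissonExponent φ m H v n) := by
  refine Finset.measurable_sum _ fun s hs => ?_
  have hs' := Finset.mem_Icc.1 hs
  have hsT : s ∈ Finset.Icc 1 I.T := Finset.mem_Icc.2 ⟨hs'.1, hs'.2.trans hn⟩
  have h1 : Measurable[ℱ n] (v s) := (hv s hsT).mono (ℱ.mono (by omega)) le_rfl
  have h2 : Measurable[ℱ n] (obs φ H s) :=
    (hφ.measurable_obs hI hsT).mono (ℱ.mono hs'.2) le_rfl
  have h3 : Measurable[ℱ n] fun ω => m ((H ω).A s) :=
    (hI.measurable_comp_action hsT m).mono (ℱ.mono (by omega)) le_rfl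
  exact (h1.mul h2).sub (h3.mul ((Real.measurable_exp.comp h1).sub_const 1))

theorem abs_exp_sub_one_le {x V : ℝ} (h : |x| ≤ V) : |Real.exp x - 1| ≤ Real.exp V := by
  have h1 : Real.exp x ≤ Real.exp V := Real.exp_le_exp.2 ((le_abs_self x).trans h)
  have h2 : 1 ≤ Real.exp V := Real.one_le_exp ((abs_nonneg x).trans h)
  rw [abs_le]
  constructor <;> linarith [Real.exp_pos x]

/-- A crude bound that serves integrability only. -/
theorem IsCoordinate.ae_poissonExponent_le [Fintype 𝒜] [IsProbabilityMeasure Pr]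
    (hφ : IsCoordinate I φ m) (hI : IsInteraction I Pr ℱ H) {v : ℕ → Ω → ℝ} {V : ℝ}
    (hV : ∀ s ω, |v s ω| ≤ V) {n : ℕ} (hn : n ≤ I.T) :
    ∀ᵐ ω ∂Pr, poissonExponent φ m H v n ω ≤ n * (V + Real.exp V) := by
  have h1 : ∀ᵐ ω ∂Pr, ∀ s ∈ Finset.Icc 1 I.T, obs φ H s ω ∈ Set.Icc (0 : ℝ) 1 := by
    exact (ae_ball_iff (Finset.countable_toSet _)).2 fun s hs => hφ.ae_obs_mem hI hs
  filter_upwards [h1] with ω hω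
  calc _ ≤ ∑ _s ∈ Finset.Icc 1 n, (V + Real.exp V) := by
        refine Finset.sum_le_sum fun s hs => ?_
        have hs' := Finset.mem_Icc.1 hs
        have hsT : s ∈ Finset.Icc 1 I.T := Finset.mem_Icc.2 ⟨hs'.1, hs'.2.trans hn⟩
        have h2 := hω s hsT
        have h3 := abs_le.1 (abs_exp_sub_one_le (hV s ω))
        have h4 := abs_le.1 (hV s ω)
        have h5 := hφ.mean_mem ((H ω).A s)
        have h6 : v s ω * obs φ H s ω ≤ V := by nlinarith [h2.1, h2.2]
        have h7 : -(m ((H ω).A s) * (Real.exp (v s ω) - 1)) ≤ Real.exp V := by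
          nlinarith [h5.1, h5.2, Real.exp_pos V]
        linarith
    _ = _ := by simp [mul_add]

theorem IsCoordinate.integrable_exp_poissonExponent [Fintype 𝒜] [IsProbabilityMeasure Pr]
    (hφ : IsCoordinate I φ m) (hI : IsInteraction I Pr ℱ H) {v : ℕ → Ω → ℝ} {V : ℝ}
    (hv : ∀ s ∈ Finset.Icc 1 I.T, Measurable[ℱ (s - 1)] (v s))
    (hV : ∀ s ω, |v s ω| ≤ V) {n : ℕ} (hn : n ≤ I.T) :
    Integrable (fun ω => Real.exp (poissonExponent φ m H v n ω)) Pr := by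
  refine Integrable.of_bound (C := Real.exp (n * (V + Real.exp V)))
    (Real.measurable_exp.comp ((hφ.measurable_poissonExponent hI hv hn).mono (ℱ.le n)
      le_rfl)).aestronglyMeasurable ?_
  filter_upwards [hφ.ae_poissonExponent_le hI hV hn] with ω hω
  rw [Real.norm_eq_abs, Real.abs_exp]
  exact Real.exp_le_exp.2 hω

/-- Given the past, the new factor has mean at most e^{-k}(1 + k) ≤ 1 with k = m(A)(e^v - 1): the
chord bound linearizes in the observation, whose conditional mean is m(A). -/
theorem IsCoordinate.integral_exp_poissonExponent_le_one [Fintype 𝒜] [IsProbabilityMeasure Pr]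
    (hφ : IsCoordinate I φ m) (hI : IsInteraction I Pr ℱ H) {v : ℕ → Ω → ℝ} {V : ℝ}
    (hv : ∀ s ∈ Finset.Icc 1 I.T, Measurable[ℱ (s - 1)] (v s))
    (hV : ∀ s ω, |v s ω| ≤ V) {n : ℕ} (hn : n ≤ I.T) :
    ∫ ω, Real.exp (poissonExponent φ m H v n ω) ∂Pr ≤ 1 := by
  induction n with
  | zero => simp [poissonExponent]
  | succ n ih =>
    refine le_trans ?_ (ih (by omega))
    have hnT : n + 1 ∈ Finset.Icc 1 I.T := Finset.mem_Icc.2 ⟨by omega, hn⟩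
    set k : Ω → ℝ := fun ω => m ((H ω).A (n + 1)) * (Real.exp (v (n + 1) ω) - 1) with hk
    set Y : Ω → ℝ := fun ω => Real.exp (poissonExponent φ m H v n ω - k ω) with hY
    -- Y + W · X is the chord bound for the next exponential; Y and W are known before round n + 1,
    -- so only X is averaged.
    set W : Ω → ℝ := fun ω => Y ω * (Real.exp (v (n + 1) ω) - 1) with hW
    have hvm : Measurable[ℱ n] (v (n + 1)) := hv (n + 1) hnT
    have hmm : Measurable[ℱ n] fun ω => m ((H ω).A (n + 1)) := hI.measurable_comp_action hnT m
    have hem : Measurable[ℱ n] fun ω => Real.exp (v (n + 1) ω) - 1 :=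
      (Real.measurable_exp.comp hvm).sub_const 1
    have hkm : Measurable[ℱ n] k := hmm.mul hem
    have hYm : Measurable[ℱ n] Y :=
      Real.measurable_exp.comp ((hφ.measurable_poissonExponent hI hv (by omega)).sub hkm)
    have hWm : Measurable[ℱ n] W := hYm.mul hem
    have hkb : ∀ ω, |k ω| ≤ Real.exp V := fun ω => by
      have h1 := hφ.mean_mem ((H ω).A (n + 1))
      rw [hk, abs_mul, abs_of_nonneg h1.1]
      nlinarith [abs_exp_sub_one_le (hV (n + 1) ω), abs_nonneg (Real.exp (v (n + 1) ω) - 1), h1.2]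
    have hYb : ∀ᵐ ω ∂Pr, Y ω ≤ Real.exp (n * (V + Real.exp V) + Real.exp V) := by
      filter_upwards [hφ.ae_poissonExponent_le hI hV (n := n) (by omega)] with ω hω
      exact Real.exp_le_exp.2 (by linarith [(abs_le.1 (hkb ω)).1])
    have hYi : Integrable Y Pr := by
      refine Integrable.of_bound (hYm.mono (ℱ.le n) le_rfl).aestronglyMeasurable
        (Real.exp (n * (V + Real.exp V) + Real.exp V)) ?_
      filter_upwards [hYb] with ω hω
      rwa [Real.norm_eq_abs, Real.abs_exp]
    have hWb : ∀ᵐ ω ∂Pr, ‖W ω‖ ≤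
        Real.exp (n * (V + Real.exp V) + Real.exp V) * Real.exp V := by
      filter_upwards [hYb] with ω hω
      rw [Real.norm_eq_abs, hW, abs_mul, Real.abs_exp]
      exact mul_le_mul hω (abs_exp_sub_one_le (hV _ _)) (abs_nonneg _) (Real.exp_pos _).le
    have hWX : Integrable (fun ω => W ω * obs φ H (n + 1) ω) Pr :=
      (hφ.integrable_obs hI hnT).bdd_mul
        (hWm.mono (ℱ.le n) le_rfl).aestronglyMeasurable hWb
    have hcond : ∫ ω, W ω * obs φ H (n + 1) ω ∂Pr = ∫ ω, W ω * m ((H ω).A (n + 1)) ∂Pr := by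
      rw [← integral_condExp (ℱ.le n) (f := fun ω => W ω * obs φ H (n + 1) ω)]
      refine integral_congr_ae ?_
      have h1 := condExp_mul_of_stronglyMeasurable_left (μ := Pr) (m := ℱ n)
        hWm.stronglyMeasurable hWX (hφ.integrable_obs hI hnT)
      refine h1.trans ?_
      filter_upwards [hφ.condExp_obs hI hnT] with ω hω
      rw [Nat.add_sub_cancel] at hω
      rw [Pi.mul_apply, hω]
    have hWmi : Integrable (fun ω => W ω * m ((H ω).A (n + 1))) Pr := by
      refine Integrable.bdd_mul (c := 1) (f := fun ω => m ((H ω).A (n + 1))) (g := W) ?_ ?_ ?_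
        |>.congr (Filter.Eventually.of_forall fun ω => mul_comm _ _)
      · exact Integrable.of_bound (hWm.mono (ℱ.le n) le_rfl).aestronglyMeasurable _ hWb
      · exact (hmm.mono (ℱ.le n) le_rfl).aestronglyMeasurable
      · refine Filter.Eventually.of_forall fun ω => ?_
        have h1 := hφ.mean_mem ((H ω).A (n + 1))
        rw [Real.norm_eq_abs, abs_of_nonneg h1.1]
        exact h1.2
    calc ∫ ω, Real.exp (poissonExponent φ m H v (n + 1) ω) ∂Pr
        ≤ ∫ ω, (Y ω + W ω * obs φ H (n + 1) ω) ∂Pr := by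
          refine integral_mono_ae (hφ.integrable_exp_poissonExponent hI hv hV hn) (hYi.add hWX) ?_
          filter_upwards [hφ.ae_obs_mem hI hnT] with ω hω
          have h1 := exp_mul_le_chord (v := v (n + 1) ω) hω.1 hω.2
          have h2 : Real.exp (poissonExponent φ m H v (n + 1) ω) =
              Y ω * Real.exp (v (n + 1) ω * obs φ H (n + 1) ω) := by
            rw [poissonExponent_succ, hY, ← Real.exp_add]
            congr 1
            simp only [hk]
            ring
          rw [h2]
          calc _ ≤ Y ω * (1 + obs φ H (n + 1) ω * (Real.exp (v (n + 1) ω) - 1)) :=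
                mul_le_mul_of_nonneg_left h1 (Real.exp_pos _).le
            _ = _ := by simp only [hW]; ring
      _ = ∫ ω, (Y ω + W ω * m ((H ω).A (n + 1))) ∂Pr := by
          rw [integral_add hYi hWX, hcond, integral_add hYi hWmi]
      _ ≤ ∫ ω, Real.exp (poissonExponent φ m H v n ω) ∂Pr := by
          refine integral_mono (hYi.add hWmi)
            (hφ.integrable_exp_poissonExponent hI hv hV (by omega)) fun ω => ?_
          have h1 : Real.exp (poissonExponent φ m H v n ω) = Y ω * Real.exp (k ω) := by
            rw [hY, ← Real.exp_add]
            congr 1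
            ring
          rw [h1]
          calc _ = Y ω * (k ω + 1) := by simp only [hW, hk]; ring
            _ ≤ _ := mul_le_mul_of_nonneg_left (Real.add_one_le_exp _) (Real.exp_pos _).le

/-- The exponential tail bound for predictable weights. -/
theorem IsCoordinate.measureReal_le [Fintype 𝒜] [IsProbabilityMeasure Pr]
    (hφ : IsCoordinate I φ m) (hI : IsInteraction I Pr ℱ H) {v : ℕ → Ω → ℝ} {V : ℝ}
    (hv : ∀ s ∈ Finset.Icc 1 I.T, Measurable[ℱ (s - 1)] (v s))
    (hV : ∀ s ω, |v s ω| ≤ V) (l : ℝ) :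
    Pr.real {ω | l ≤ poissonExponent φ m H v I.T ω} ≤ Real.exp (-l) := by
  have h1 := mul_meas_ge_le_integral_of_nonneg
    (Filter.Eventually.of_forall fun ω => (Real.exp_pos (poissonExponent φ m H v I.T ω)).le)
    (hφ.integrable_exp_poissonExponent hI hv hV le_rfl) (Real.exp l)
  simp only [Real.exp_le_exp] at h1
  have h2 := h1.trans (hφ.integral_exp_poissonExponent_le_one hI hv hV le_rfl)
  rw [Real.exp_neg, ← one_div, le_div_iff₀' (Real.exp_pos l)]
  exact h2

end Concentration

/-! ### Sums over the first pulls of an arm -/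

section ArmSums

variable {𝒜 : Type*} [DecidableEq 𝒜]

/-- The number of pulls of `a` before round `t` along the action sequence `A`. -/
def pullCount (A : ℕ → 𝒜) (t : ℕ) (a : 𝒜) : ℕ := ((Finset.Ico 1 t).filter (fun s => A s = a)).card

/-- The sum of `x` over those of the first `n` pulls of `a` that happen in rounds `1, …, T`. -/
noncomputable def armSum (A : ℕ → 𝒜) (T : ℕ) (a : 𝒜) (n : ℕ) (x : ℕ → ℝ) : ℝ :=
  ∑ s ∈ Finset.Icc 1 T, (if A s = a ∧ pullCount A s a < n then 1 else 0) * x s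

theorem pullCount_mono (A : ℕ → 𝒜) (a : 𝒜) {s t : ℕ} (h : s ≤ t) :
    pullCount A s a ≤ pullCount A t a :=
  Finset.card_le_card (Finset.filter_subset_filter _ (Finset.Ico_subset_Ico_right h))

theorem pullCount_succ (A : ℕ → 𝒜) (a : 𝒜) {t : ℕ} (ht : 1 ≤ t) :
    pullCount A (t + 1) a = pullCount A t a + if A t = a then 1 else 0 := by
  rw [pullCount, pullCount, Finset.card_filter, Finset.card_filter, Finset.sum_Ico_succ_top ht]

theorem pullCount_lt (A : ℕ → 𝒜) (a : 𝒜) {t : ℕ} (ht : 1 ≤ t) : pullCount A t a < t :=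
  (Finset.card_filter_le _ _).trans_lt (by rw [Nat.card_Ico]; omega)

/-- A pull of `a` precedes round t exactly when its rank is below the count at t. Sums with a random
number of terms thus become sums indexed by a deterministic n, over which a union bound can be
taken. -/
theorem armSum_pullCount (A : ℕ → 𝒜) (a : 𝒜) {t T : ℕ} (ht : t ∈ Finset.Icc 1 T) (x : ℕ → ℝ) :
    armSum A T a (pullCount A t a) x = ∑ s ∈ Finset.Ico 1 t, if A s = a then x s else 0 := by
  have ht' := Finset.mem_Icc.1 ht
  have hsub : Finset.Ico 1 t ⊆ Finset.Icc 1 T := fun s hs => by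
    simp only [Finset.mem_Ico, Finset.mem_Icc] at hs ⊢
    omega
  rw [armSum, ← Finset.sum_subset hsub]
  · refine Finset.sum_congr rfl fun s hs => ?_
    have hs' := Finset.mem_Ico.1 hs
    by_cases h : A s = a
    · have h1 := pullCount_succ A a hs'.1
      rw [if_pos h] at h1
      have h2 := pullCount_mono A a (show s + 1 ≤ t from hs'.2)
      rw [if_pos ⟨h, by omega⟩, if_pos h, one_mul]
    · simp [h]
  · intro s hs hs'
    have : t ≤ s := by
      simp only [Finset.mem_Ico, Finset.mem_Icc] at hs hs'
      omega
    have := pullCount_mono A a this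
    rw [if_neg (by rintro ⟨-, h⟩; omega), zero_mul]

/-- Discharges the guard in the deviation events, which says that n pulls of the arm do occur. -/
theorem armSum_pullCount_one (A : ℕ → 𝒜) (a : 𝒜) {t T : ℕ} (ht : t ∈ Finset.Icc 1 T) :
    armSum A T a (pullCount A t a) (fun _ => 1) = pullCount A t a := by
  rw [armSum_pullCount A a ht, pullCount, Finset.card_filter]
  push_cast
  rfl

end ArmSums

theorem Instance.qhi_pos {𝒜 : Type*} {d : ℕ} (I : Instance 𝒜 d) : 0 < I.qhi :=
  I.qlo_pos.trans I.qlo_lt_qhi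

theorem Instance.q_pos {𝒜 : Type*} {d : ℕ} (I : Instance 𝒜 d) {t : ℕ}
    (ht : t ∈ Finset.Icc 1 I.T) : 0 < I.q t :=
  I.qlo_pos.trans_le (I.q_mem t ht).1

theorem measureReal_not_and_le {Ω : Type*} {mΩ : MeasurableSpace Ω} {Pr : Measure Ω}
    [IsFiniteMeasure Pr] {p q : Ω → Prop} {e f : ℝ} (hp : Pr.real {ω | ¬ p ω} ≤ e)
    (hq : Pr.real {ω | ¬ q ω} ≤ f) : Pr.real {ω | ¬ (p ω ∧ q ω)} ≤ e + f := by
  have h : {ω | ¬ (p ω ∧ q ω)} ⊆ {ω | ¬ p ω} ∪ {ω | ¬ q ω} := fun ω hω => not_and_or.1 hω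
  exact (measureReal_mono h).trans ((measureReal_union_le _ _).trans (add_le_add hp hq))

theorem measureReal_not_forall_le {ι Ω : Type*} {mΩ : MeasurableSpace Ω} {Pr : Measure Ω}
    (s : Finset ι) {p : ι → Ω → Prop} {e : ℝ}
    (h : ∀ i ∈ s, Pr.real {ω | ¬ p i ω} ≤ e) :
    Pr.real {ω | ¬ ∀ i ∈ s, p i ω} ≤ s.card * e := by
  have h1 : {ω | ¬ ∀ i ∈ s, p i ω} = ⋃ i ∈ s, {ω | ¬ p i ω} := by
    ext ω
    simp
  rw [h1]
  refine (measureReal_biUnion_finset_le s _).trans ?_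
  rw [← nsmul_eq_mul]
  exact Finset.sum_le_card_nsmul s _ _ h

theorem measureReal_not_forall_arm_le {𝒜 Ω : Type*} [Fintype 𝒜] {mΩ : MeasurableSpace Ω}
    {Pr : Measure Ω} {T : ℕ} {p : 𝒜 → ℕ → Ω → Prop} {e : ℝ}
    (h : ∀ a, ∀ n ∈ Finset.Icc 1 T, Pr.real {ω | ¬ p a n ω} ≤ e) :
    Pr.real {ω | ¬ ∀ a, ∀ n ∈ Finset.Icc 1 T, p a n ω} ≤ Fintype.card 𝒜 * T * e := by
  have h1 := measureReal_not_forall_le (Pr := Pr) (Finset.univ (α := 𝒜)) (e := T * e)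
    (p := fun a ω => ∀ n ∈ Finset.Icc 1 T, p a n ω) fun a _ => by
      simpa using measureReal_not_forall_le (Finset.Icc 1 T) (h a)
  simpa [mul_assoc] using h1

/-- Being among the first n pulls is decided before the outcome of the round, so its indicator is an
admissible weight. -/
theorem IsInteraction.measurableSet_pullCount_lt {𝒜 : Type*} [DecidableEq 𝒜] {d : ℕ} {Ω : Type*}
    {mΩ : MeasurableSpace Ω} {I : Instance 𝒜 d} {Pr : Measure Ω} {ℱ : Filtration ℕ mΩ}
    {H : Ω → Trajectory 𝒜 d} (hI : IsInteraction I Pr ℱ H) {s : ℕ}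
    (hs : s ∈ Finset.Icc 1 I.T) (a : 𝒜) (n : ℕ) :
    MeasurableSet[ℱ (s - 1)] {ω | pullCount (H ω).A s a < n} := by
  have h1 : Measurable[ℱ (s - 1)] fun ω => pullCount (H ω).A s a := by
    simp only [pullCount, Finset.card_filter]
    refine Finset.measurable_sum _ fun u hu => ?_
    have hs' := Finset.mem_Icc.1 hs
    have hu' := Finset.mem_Ico.1 hu
    refine Measurable.ite ?_ measurable_const measurable_const
    exact ℱ.mono (by omega) _ (hI.action u (Finset.mem_Icc.2 ⟨by omega, by omega⟩) a)
  exact h1 (measurableSet_Iio (a := n))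

/-- Deviations of the observations `x` from the means `m` along the actions `A`, with weights `q`
bounded by `qhi`: multiplicative bounds at level `l` and scale `γ`. -/
structure MultDev {𝒜 : Type*} [DecidableEq 𝒜] (A : ℕ → 𝒜) (T : ℕ) (q : ℕ → ℝ) (qhi : ℝ)
    (x : ℕ → ℝ) (m : 𝒜 → ℝ) (γ l : ℝ) : Prop where
  arm_le : ∀ a, ∀ n ∈ Finset.Icc 1 T, armSum A T a n (fun _ => 1) = n →
    armSum A T a n x ≤ (1 + γ) * (n * m a) + l / γ
  le_arm : ∀ a, ∀ n ∈ Finset.Icc 1 T, armSum A T a n (fun _ => 1) = n →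
    (1 - γ) * (n * m a) - l / γ ≤ armSum A T a n x
  sum_le : ∀ n ∈ Finset.Icc 1 T, ∑ s ∈ Finset.Icc 1 n, q s * x s ≤
    (1 + γ) * ∑ s ∈ Finset.Icc 1 n, q s * m (A s) + l * qhi / γ
  le_sum : ∀ n ∈ Finset.Icc 1 T, (1 - γ) * ∑ s ∈ Finset.Icc 1 n, q s * m (A s) - l * qhi / γ ≤
    ∑ s ∈ Finset.Icc 1 n, q s * x s

/-! ### Tails of the demand-weighted sums -/

section WeightedTails

variable {𝒜 : Type*} [Fintype 𝒜] {d : ℕ} {Ω : Type*} {mΩ : MeasurableSpace Ω}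
  {I : Instance 𝒜 d} {Pr : Measure Ω} [IsProbabilityMeasure Pr] {ℱ : Filtration ℕ mΩ}
  {H : Ω → Trajectory 𝒜 d} {φ : ℝ × (Fin d → ℝ) → ℝ} {m : 𝒜 → ℝ}


/-- Exponential tail bound for the demand-weighted sums over the first `n` rounds. -/
theorem IsCoordinate.weighted_tail (hφ : IsCoordinate I φ m) (hI : IsInteraction I Pr ℱ H)
    {n : ℕ} (hn : n ≤ I.T) (v l : ℝ) :
    Pr.real {ω | l ≤ ∑ s ∈ Finset.Icc 1 n, (v * I.q s / I.qhi * obs φ H s ω -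
      m ((H ω).A s) * (Real.exp (v * I.q s / I.qhi) - 1))} ≤ Real.exp (-l) := by
  -- Weights vanish after round n, so the bound at horizon T covers the prefix; division by q̄ keeps
  -- them within |v|.
  set w : ℕ → Ω → ℝ := fun s _ => if s ∈ Finset.Icc 1 n then v * I.q s / I.qhi else 0 with hw
  have hwV : ∀ s ω, |w s ω| ≤ |v| := fun s ω => by
    simp only [hw]
    split_ifs with h
    · have h' := Finset.mem_Icc.1 h
      have h1 := I.q_mem s (Finset.mem_Icc.2 ⟨h'.1, h'.2.trans hn⟩)
      have h2 : 0 < I.qhi := I.qlo_pos.trans I.qlo_lt_qhi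
      have h3 : 0 ≤ I.q s := I.qlo_pos.le.trans h1.1
      rw [abs_div, abs_mul, abs_of_pos h2, abs_of_nonneg h3, div_le_iff₀ h2]
      exact mul_le_mul_of_nonneg_left h1.2 (abs_nonneg _)
    · simp
  refine le_trans (measureReal_mono ?_)
    (hφ.measureReal_le hI (v := w) (fun s _ => measurable_const) hwV l)
  intro ω h
  refine le_trans (Set.mem_ofPred_eq ▸ h) (le_of_eq ?_)
  rw [poissonExponent, ← Finset.sum_subset (Finset.Icc_subset_Icc_right hn)]
  · refine Finset.sum_congr rfl fun s hs => ?_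
    simp only [hw, if_pos hs]
  · intro s _ hs
    simp only [hw, if_neg hs]
    simp

/-- Take v = γ in the exponential bound: each exponent y = γq_s/q̄ lies in [0, γ], where e^y - 1 ≤
y(1 + γ). The lower tail uses v = -γ in the same way. -/
theorem IsCoordinate.weighted_upper_tail (hφ : IsCoordinate I φ m) (hI : IsInteraction I Pr ℱ H)
    {n : ℕ} (hn : n ≤ I.T) {γ : ℝ} (h0 : 0 < γ) (h1 : γ ≤ 1) (l : ℝ) :
    Pr.real {ω | ¬ (∑ s ∈ Finset.Icc 1 n, I.q s * obs φ H s ω ≤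
      (1 + γ) * ∑ s ∈ Finset.Icc 1 n, I.q s * m ((H ω).A s) + l * I.qhi / γ)} ≤
      Real.exp (-l) := by
  refine le_trans (measureReal_mono ?_) (hφ.weighted_tail hI hn γ l)
  intro ω hω
  simp only [Set.mem_ofPred_eq, not_le] at hω ⊢
  have hq := I.qhi_pos
  have h2 : ∑ s ∈ Finset.Icc 1 n, (γ / I.qhi * (I.q s * obs φ H s ω) -
        γ / I.qhi * (1 + γ) * (I.q s * m ((H ω).A s))) ≤
      ∑ s ∈ Finset.Icc 1 n, (γ * I.q s / I.qhi * obs φ H s ω -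
        m ((H ω).A s) * (Real.exp (γ * I.q s / I.qhi) - 1)) := by
    refine Finset.sum_le_sum fun s hs => ?_
    have hs' := Finset.mem_Icc.1 hs
    have hsT : s ∈ Finset.Icc 1 I.T := Finset.mem_Icc.2 ⟨hs'.1, hs'.2.trans hn⟩
    have h3 := I.q_pos hsT
    have h4 : I.q s / I.qhi ≤ 1 := (div_le_one hq).2 (I.q_mem s hsT).2
    set y := γ * I.q s / I.qhi with hy
    have hy0 : 0 ≤ y := by positivity
    have hyγ : y ≤ γ := by
      rw [hy, mul_div_assoc]
      exact mul_le_of_le_one_right h0.le h4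
    have h5 := exp_le_one_add_add_sq hy0 (hyγ.trans h1)
    have h6 : Real.exp y - 1 ≤ y * (1 + γ) := by nlinarith
    have h7 := mul_le_mul_of_nonneg_left h6 (hφ.mean_mem ((H ω).A s)).1
    have h8 : γ / I.qhi * (I.q s * obs φ H s ω) = y * obs φ H s ω := by rw [hy]; ring
    have h9 : γ / I.qhi * (1 + γ) * (I.q s * m ((H ω).A s)) =
        m ((H ω).A s) * (y * (1 + γ)) := by rw [hy]; ring
    linarith
  refine le_trans ?_ h2
  rw [Finset.sum_sub_distrib, ← Finset.mul_sum, ← Finset.mul_sum]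
  have h3 := mul_le_mul_of_nonneg_left hω.le (show 0 ≤ γ / I.qhi by positivity)
  have h4 : γ / I.qhi * (l * I.qhi / γ) = l := by field_simp
  linarith

theorem IsCoordinate.weighted_lower_tail (hφ : IsCoordinate I φ m) (hI : IsInteraction I Pr ℱ H)
    {n : ℕ} (hn : n ≤ I.T) {γ : ℝ} (h0 : 0 < γ) (l : ℝ) :
    Pr.real {ω | ¬ ((1 - γ) * ∑ s ∈ Finset.Icc 1 n, I.q s * m ((H ω).A s) - l * I.qhi / γ ≤
      ∑ s ∈ Finset.Icc 1 n, I.q s * obs φ H s ω)} ≤ Real.exp (-l) := by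
  refine le_trans (measureReal_mono ?_) (hφ.weighted_tail hI hn (-γ) l)
  intro ω hω
  simp only [Set.mem_ofPred_eq, not_le] at hω ⊢
  have hq := I.qhi_pos
  have h2 : ∑ s ∈ Finset.Icc 1 n, (γ / I.qhi * (1 - γ) * (I.q s * m ((H ω).A s)) -
        γ / I.qhi * (I.q s * obs φ H s ω)) ≤
      ∑ s ∈ Finset.Icc 1 n, (-γ * I.q s / I.qhi * obs φ H s ω -
        m ((H ω).A s) * (Real.exp (-γ * I.q s / I.qhi) - 1)) := by
    refine Finset.sum_le_sum fun s hs => ?_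
    have hs' := Finset.mem_Icc.1 hs
    have hsT : s ∈ Finset.Icc 1 I.T := Finset.mem_Icc.2 ⟨hs'.1, hs'.2.trans hn⟩
    have h3 := I.q_pos hsT
    have h4 : I.q s / I.qhi ≤ 1 := (div_le_one hq).2 (I.q_mem s hsT).2
    set y := γ * I.q s / I.qhi with hy
    have hy0 : 0 ≤ y := by positivity
    have hyγ : y ≤ γ := by
      rw [hy, mul_div_assoc]
      exact mul_le_of_le_one_right h0.le h4
    have h5 := exp_neg_le_quadratic hy0
    have h6 : y * (1 - γ) ≤ -(Real.exp (-y) - 1) := by nlinarith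
    have h7 := mul_le_mul_of_nonneg_left h6 (hφ.mean_mem ((H ω).A s)).1
    have h8 : γ / I.qhi * (I.q s * obs φ H s ω) = y * obs φ H s ω := by rw [hy]; ring
    have h9 : γ / I.qhi * (1 - γ) * (I.q s * m ((H ω).A s)) =
        m ((H ω).A s) * (y * (1 - γ)) := by rw [hy]; ring
    have h10 : -γ * I.q s / I.qhi = -y := by rw [hy]; ring
    rw [h10]
    linarith
  refine le_trans ?_ h2
  rw [Finset.sum_sub_distrib, ← Finset.mul_sum, ← Finset.mul_sum]
  have h3 := mul_le_mul_of_nonneg_left hω.le (show 0 ≤ γ / I.qhi by positivity)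
  have h4 : γ / I.qhi * (l * I.qhi / γ) = l := by field_simp
  linarith

end WeightedTails

/-! ### Tails of the sums over the pulls of one arm -/

section Tails

variable {𝒜 : Type*} [Fintype 𝒜] [DecidableEq 𝒜] {d : ℕ} {Ω : Type*} {mΩ : MeasurableSpace Ω}
  {I : Instance 𝒜 d} {Pr : Measure Ω} [IsProbabilityMeasure Pr] {ℱ : Filtration ℕ mΩ}
  {H : Ω → Trajectory 𝒜 d} {φ : ℝ × (Fin d → ℝ) → ℝ} {m : 𝒜 → ℝ}


/-- If all n pulls occur, the compensator of the supermartingale is the deterministic number n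
m(a)(e^v - 1). -/
theorem IsCoordinate.arm_tail (hφ : IsCoordinate I φ m) (hI : IsInteraction I Pr ℱ H)
    (a : 𝒜) (n : ℕ) (v l : ℝ) :
    Pr.real {ω | armSum (H ω).A I.T a n (fun _ => 1) = n ∧
      l ≤ v * armSum (H ω).A I.T a n (fun s => obs φ H s ω) - n * m a * (Real.exp v - 1)} ≤
      Real.exp (-l) := by
  set w : ℕ → Ω → ℝ := fun s ω => if (H ω).A s = a ∧ pullCount (H ω).A s a < n then 1 else 0
    with hw
  have hwm : ∀ s ∈ Finset.Icc 1 I.T, Measurable[ℱ (s - 1)] (fun ω => v * w s ω) := fun s hs => by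
    refine Measurable.const_mul ?_ v
    refine Measurable.ite ?_ measurable_const measurable_const
    exact (hI.action s hs a).inter (hI.measurableSet_pullCount_lt hs a n)
  have hwV : ∀ s ω, |v * w s ω| ≤ |v| := fun s ω => by
    simp only [hw]
    split_ifs <;> simp
  refine le_trans (measureReal_mono ?_) (hφ.measureReal_le hI hwm hwV l)
  rintro ω ⟨h1, h2⟩
  refine h2.trans (le_of_eq ?_)
  rw [poissonExponent, Finset.sum_sub_distrib]
  congr 1
  · rw [armSum, Finset.mul_sum]
    exact Finset.sum_congr rfl fun s _ => by simp only [hw]; ring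
  · rw [← h1, armSum, Finset.sum_mul, Finset.sum_mul]
    refine Finset.sum_congr rfl fun s _ => ?_
    simp only [hw]
    split_ifs with h
    · rw [h.1]; simp
    · simp

theorem IsCoordinate.arm_lower_tail (hφ : IsCoordinate I φ m) (hI : IsInteraction I Pr ℱ H)
    (a : 𝒜) {n : ℕ} (hn : 1 ≤ n) {l : ℝ} (hl : 0 ≤ l) :
    Pr.real {ω | ¬ (armSum (H ω).A I.T a n (fun _ => 1) = n → 0 < m a →
      n * m a - √(2 * (n * m a) * l) ≤ armSum (H ω).A I.T a n (fun s => obs φ H s ω))} ≤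
      Real.exp (-l) := by
  set p : ℝ := n * m a with hp
  -- Optimal for the quadratic bound on the exponent: it makes px²/2 = l. It needs p > 0, hence the
  -- guard on m a.
  set x : ℝ := √(2 * l / p) with hx
  refine le_trans (measureReal_mono ?_) (hφ.arm_tail hI a n (-x) l)
  intro ω hω
  simp only [Set.mem_ofPred_eq, Classical.not_imp, not_le] at hω ⊢
  obtain ⟨h1, h2, h3⟩ := hω
  refine ⟨h1, ?_⟩
  have hp0 : 0 < p := mul_pos (by exact_mod_cast hn) h2
  have hx0 : 0 ≤ x := Real.sqrt_nonneg _
  have hx2 : p * x ^ 2 = 2 * l := by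
    rw [hx, Real.sq_sqrt (by positivity)]
    field_simp
  have h4 : √(2 * p * l) = p * x := by
    rw [Real.sqrt_eq_iff_mul_self_eq (by positivity) (by positivity)]
    linear_combination -p * hx2
  rw [h4] at h3
  have h5 := mul_le_mul_of_nonneg_left (exp_neg_le_quadratic hx0) hp0.le
  have h6 := mul_le_mul_of_nonneg_left h3.le hx0
  linarith

theorem IsCoordinate.arm_upper_tail (hφ : IsCoordinate I φ m) (hI : IsInteraction I Pr ℱ H)
    (a : 𝒜) (n : ℕ) {l : ℝ} (hl : 0 ≤ l) :
    Pr.real {ω | ¬ (armSum (H ω).A I.T a n (fun _ => 1) = n →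
      armSum (H ω).A I.T a n (fun s => obs φ H s ω) ≤ n * m a + √(2 * (n * m a) * l) + l)} ≤
      Real.exp (-l) := by
  set p : ℝ := n * m a with hp
  have hp0 : 0 ≤ p := mul_nonneg (by positivity) (hφ.mean_mem a).1
  rcases hp0.eq_or_lt with h0 | h0
  -- With mean 0 the compensator vanishes and v = 1 suffices.
  · refine le_trans (measureReal_mono ?_) (hφ.arm_tail hI a n 1 l)
    intro ω hω
    simp only [Set.mem_ofPred_eq, Classical.not_imp, not_le] at hω ⊢
    obtain ⟨h1, h3⟩ := hω
    refine ⟨h1, ?_⟩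
    rw [← hp, ← h0] at *
    simp at h3 ⊢
    exact h3.le
  · set s : ℝ := √(2 * l / p) with hs
    have hs0 : 0 ≤ s := Real.sqrt_nonneg _
    -- With ps² = 2l, this v turns the sub-gamma exponent at the deviation ps + l into exactly l.
    refine le_trans (measureReal_mono ?_) (hφ.arm_tail hI a n (s / (1 + s)) l)
    intro ω hω
    simp only [Set.mem_ofPred_eq, Classical.not_imp, not_le] at hω ⊢
    obtain ⟨h1, h3⟩ := hω
    refine ⟨h1, ?_⟩
    have hs2 : p * s ^ 2 = 2 * l := by
      rw [hs, Real.sq_sqrt (by positivity)]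
      field_simp
    have h4 : √(2 * p * l) = p * s := by
      rw [Real.sqrt_eq_iff_mul_self_eq (by positivity) (by positivity)]
      linear_combination -p * hs2
    rw [h4] at h3
    have hs1 : s / (1 + s) < 1 := by rw [div_lt_one (by positivity)]; linarith
    have h5 := mul_le_mul_of_nonneg_left (exp_le_sub_gamma (by positivity) hs1) hp0
    have h6 := mul_le_mul_of_nonneg_left h3.le (show 0 ≤ s / (1 + s) by positivity)
    have h7 : (s / (1 + s)) ^ 2 / (2 * (1 - s / (1 + s))) = s ^ 2 / (2 * (1 + s)) := by
      have : 1 - s / (1 + s) = 1 / (1 + s) := by field_simp; ring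
      rw [this]
      field_simp
    rw [h7] at h5
    have h8 : s / (1 + s) * (p + p * s + l) - p * (s / (1 + s) + s ^ 2 / (2 * (1 + s))) = l := by
      have : l = p * s ^ 2 / 2 := by linarith
      rw [this]
      field_simp
      ring
    rw [← hp]
    linarith

theorem IsCoordinate.arm_multiplicative_upper_tail (hφ : IsCoordinate I φ m)
    (hI : IsInteraction I Pr ℱ H) (a : 𝒜) (n : ℕ) {γ : ℝ} (h0 : 0 < γ) (h1 : γ ≤ 1) (l : ℝ) :
    Pr.real {ω | ¬ (armSum (H ω).A I.T a n (fun _ => 1) = n →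
      armSum (H ω).A I.T a n (fun s => obs φ H s ω) ≤ (1 + γ) * (n * m a) + l / γ)} ≤
      Real.exp (-l) := by
  refine le_trans (measureReal_mono ?_) (hφ.arm_tail hI a n γ l)
  intro ω hω
  simp only [Set.mem_ofPred_eq, Classical.not_imp, not_le] at hω ⊢
  obtain ⟨h2, h3⟩ := hω
  refine ⟨h2, ?_⟩
  have hp0 : 0 ≤ n * m a := mul_nonneg (by positivity) (hφ.mean_mem a).1
  have h4 := mul_le_mul_of_nonneg_left (exp_le_one_add_add_sq h0.le h1) hp0
  have h5 := mul_le_mul_of_nonneg_left h3.le h0.le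
  have h6 : γ * (l / γ) = l := by field_simp
  linarith

theorem IsCoordinate.arm_multiplicative_lower_tail (hφ : IsCoordinate I φ m)
    (hI : IsInteraction I Pr ℱ H) (a : 𝒜) (n : ℕ) {γ : ℝ} (h0 : 0 < γ) (l : ℝ) :
    Pr.real {ω | ¬ (armSum (H ω).A I.T a n (fun _ => 1) = n →
      (1 - γ) * (n * m a) - l / γ ≤ armSum (H ω).A I.T a n (fun s => obs φ H s ω))} ≤
      Real.exp (-l) := by
  refine le_trans (measureReal_mono ?_) (hφ.arm_tail hI a n (-γ) l)
  intro ω hω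
  simp only [Set.mem_ofPred_eq, Classical.not_imp, not_le] at hω ⊢
  obtain ⟨h2, h3⟩ := hω
  refine ⟨h2, ?_⟩
  have hp0 : 0 ≤ n * m a := mul_nonneg (by positivity) (hφ.mean_mem a).1
  have h4 := mul_le_mul_of_nonneg_left (exp_neg_le_quadratic h0.le) hp0
  have h5 := mul_le_mul_of_nonneg_left h3.le h0.le
  have h6 : γ * (l / γ) = l := by field_simp
  have h7 : 0 ≤ n * m a * γ ^ 2 := by positivity
  linarith

theorem IsCoordinate.measureReal_not_multDev_le (hφ : IsCoordinate I φ m)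
    (hI : IsInteraction I Pr ℱ H) {γ : ℝ} (h0 : 0 < γ) (h1 : γ ≤ 1) (l : ℝ) :
    Pr.real {ω | ¬ MultDev (H ω).A I.T I.q I.qhi (fun s => obs φ H s ω) m γ l} ≤
      4 * (Fintype.card 𝒜 * I.T * Real.exp (-l)) := by
  have e1 := measureReal_not_forall_arm_le fun a n (_ : n ∈ Finset.Icc 1 I.T) =>
    hφ.arm_multiplicative_upper_tail hI a n h0 h1 l
  have e2 := measureReal_not_forall_arm_le fun a n (_ : n ∈ Finset.Icc 1 I.T) =>
    hφ.arm_multiplicative_lower_tail hI a n h0 l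
  have e3 := measureReal_not_forall_le (Finset.Icc 1 I.T) fun n hn =>
    hφ.weighted_upper_tail hI (Finset.mem_Icc.1 hn).2 h0 h1 l
  have e4 := measureReal_not_forall_le (Finset.Icc 1 I.T) fun n hn =>
    hφ.weighted_lower_tail hI (Finset.mem_Icc.1 hn).2 h0 l
  have hK : (1 : ℝ) ≤ Fintype.card 𝒜 := by
    exact_mod_cast Fintype.card_pos_iff.2 ⟨I.nullAction⟩
  have h2 : (I.T : ℝ) * Real.exp (-l) ≤ Fintype.card 𝒜 * I.T * Real.exp (-l) := by
    rw [mul_assoc]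
    exact le_mul_of_one_le_left (by positivity) hK
  rw [Nat.card_Icc, Nat.add_sub_cancel] at e3 e4
  have h3 := measureReal_not_and_le (measureReal_not_and_le e1 e2) (measureReal_not_and_le e3 e4)
  refine (measureReal_mono ?_).trans (h3.trans (by linarith))
  exact fun ω hω h => hω ⟨h.1.1, h.1.2, h.2.1, h.2.2⟩

end Tails

/-! ### Confidence bounds -/

section Radius

/-- The deviation is stated at the unknown mean p and the radius at the observed x. Solving the
quadratic inequality in p trades one for the other, and the 4y of the radius pays for it. -/
theorem le_add_sqrt_of_sub_sqrt_le {p x y : ℝ} (hx : 0 ≤ x) (hy : 0 ≤ y)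
    (h : p - √(2 * p * y) ≤ x) (hp : 0 ≤ p) : p ≤ x + (√(2 * x * y) + 4 * y) := by
  by_contra! hlt
  set u := √(2 * x * y) with hu
  have hu0 : 0 ≤ u := Real.sqrt_nonneg _
  have hu2 : u ^ 2 = 2 * x * y := Real.sq_sqrt (by positivity)
  have hv2 : √(2 * p * y) ^ 2 = 2 * p * y := Real.sq_sqrt (by positivity)
  have h1 : (p - x) ^ 2 ≤ 2 * p * y := by
    rw [← hv2]
    have : 0 ≤ p - x := by linarith
    gcongr
    linarith
  nlinarith

theorem sub_sqrt_le_of_le_add_sqrt {c x y : ℝ} (hy : 0 ≤ y)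
    (h : x ≤ c + √(2 * c * y) + y) : x - (√(2 * x * y) + 4 * y) ≤ c := by
  rcases le_total x c with hxc | hxc
  · linarith [Real.sqrt_nonneg (2 * x * y)]
  · have : √(2 * c * y) ≤ √(2 * x * y) := by gcongr
    linarith

/-- The arithmetic-geometric mean inequality at scale γ. Linearizing the radius lets errors be
summed over rounds directly. -/
theorem sqrt_add_le_mul_add {x y γ : ℝ} (hx : 0 ≤ x) (hy : 0 ≤ y) (h0 : 0 < γ) (h1 : γ ≤ 1) :
    √(2 * x * y) + 4 * y ≤ γ * x + 5 * (y / γ) := by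
  have h2 : y ≤ y / γ := (le_div_iff₀ h0).2 (mul_le_of_le_one_right hy h1)
  have h3 : √(2 * x * y) ≤ γ * x + y / γ := by
    rw [Real.sqrt_le_left (by positivity)]
    have h4 : γ * x * (y / γ) = x * y := by field_simp
    nlinarith [sq_nonneg (γ * x), sq_nonneg (y / γ)]
  linarith

theorem rad_eq (v N δ : ℝ) :
    rad v N δ = √(2 * v * (Real.log (1 / δ) / N)) + 4 * (Real.log (1 / δ) / N) := by
  rw [rad, mul_div_assoc, mul_div_assoc]

end Radius

section SampleMeans

variable {𝒜 : Type*} [DecidableEq 𝒜] {A : ℕ → 𝒜} {T : ℕ} {x : ℕ → ℝ} {m : 𝒜 → ℝ} {δ γ : ℝ}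

/-- Lower deviations of the sums over the first pulls of every arm. -/
def LowerDev (A : ℕ → 𝒜) (T : ℕ) (x : ℕ → ℝ) (m : 𝒜 → ℝ) (l : ℝ) : Prop :=
  ∀ a, ∀ n ∈ Finset.Icc 1 T, armSum A T a n (fun _ => 1) = n → 0 < m a →
    n * m a - √(2 * (n * m a) * l) ≤ armSum A T a n x

/-- Upper deviations of the sums over the first pulls of every arm. -/
def UpperDev (A : ℕ → 𝒜) (T : ℕ) (x : ℕ → ℝ) (m : 𝒜 → ℝ) (l : ℝ) : Prop :=
  ∀ a, ∀ n ∈ Finset.Icc 1 T, armSum A T a n (fun _ => 1) = n →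
    armSum A T a n x ≤ n * m a + √(2 * (n * m a) * l) + l

/-- The mean of the observations `x` of `a` before round `t`. -/
noncomputable def sampleMean (A : ℕ → 𝒜) (x : ℕ → ℝ) (t : ℕ) (a : 𝒜) : ℝ :=
  (∑ s ∈ Finset.Ico 1 t, if A s = a then x s else 0) / (max (pullCount A t a) 1 : ℕ)

theorem sampleMean_eq {t : ℕ} (ht : t ∈ Finset.Icc 1 T) (a : 𝒜) :
    sampleMean A x t a = armSum A T a (pullCount A t a) x / (max (pullCount A t a) 1 : ℕ) := by
  rw [sampleMean, armSum_pullCount A a ht]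

theorem sampleMean_of_pullCount_eq_zero {t : ℕ} {a : 𝒜} (h : pullCount A t a = 0) :
    sampleMean A x t a = 0 := by
  rw [sampleMean, Finset.sum_eq_zero, zero_div]
  intro s hs
  rw [pullCount, Finset.card_eq_zero, Finset.filter_eq_empty_iff] at h
  exact if_neg (h hs)

theorem sampleMean_nonneg (hx : ∀ s ∈ Finset.Icc 1 T, 0 ≤ x s) {t : ℕ} (ht : t ∈ Finset.Icc 1 T)
    (a : 𝒜) : 0 ≤ sampleMean A x t a := by
  refine div_nonneg (Finset.sum_nonneg fun s hs => ?_) (Nat.cast_nonneg _)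
  have ht' := Finset.mem_Icc.1 ht
  have hs' := Finset.mem_Ico.1 hs
  split_ifs
  · exact hx s (Finset.mem_Icc.2 ⟨hs'.1, by omega⟩)
  · exact le_rfl

theorem pullCount_mem {t : ℕ} (ht : t ∈ Finset.Icc 1 T) {a : 𝒜} (h : pullCount A t a ≠ 0) :
    pullCount A t a ∈ Finset.Icc 1 T := by
  have ht' := Finset.mem_Icc.1 ht
  have := pullCount_lt A a ht'.1
  exact Finset.mem_Icc.2 ⟨by omega, by omega⟩

theorem le_sampleMean_add_rad (hL : 1 ≤ Real.log (1 / δ))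
    (hdev : LowerDev A T x m (Real.log (1 / δ))) (hm : ∀ a, m a ∈ Set.Icc (0 : ℝ) 1)
    (hx : ∀ s ∈ Finset.Icc 1 T, 0 ≤ x s) {t : ℕ} (ht : t ∈ Finset.Icc 1 T) (a : 𝒜) :
    m a ≤ min (sampleMean A x t a +
      rad (sampleMean A x t a) (max (pullCount A t a) 1 : ℕ) δ) 1 := by
  refine le_min ?_ (hm a).2
  have h0 := sampleMean_nonneg (A := A) hx ht a
  rw [rad_eq]
  -- Before the first pull the sample mean is 0 and the radius is 4 log(1/δ) ≥ 1.
  by_cases hn : pullCount A t a = 0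
  · rw [sampleMean_of_pullCount_eq_zero hn, hn]
    simp only [zero_add, mul_zero, zero_mul, Real.sqrt_zero]
    norm_num
    linarith [(hm a).2, one_div δ ▸ hL, Real.log_inv δ]
  · have hn1 : max (pullCount A t a) 1 = pullCount A t a := by omega
    have hnpos : (0 : ℝ) < pullCount A t a := by exact_mod_cast Nat.pos_of_ne_zero hn
    have hy : 0 ≤ Real.log (1 / δ) / pullCount A t a := by positivity
    -- `LowerDev` says nothing when m a = 0, but then the bound is immediate.
    rcases (hm a).1.eq_or_lt with h | h
    · rw [← h, hn1]
      positivity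
    · have h1 := hdev a _ (pullCount_mem ht hn) (armSum_pullCount_one A a ht) h
      rw [sampleMean_eq ht, hn1] at h0 ⊢
      refine le_add_sqrt_of_sub_sqrt_le h0 hy ?_ h.le
      rw [le_div_iff₀ hnpos]
      refine le_trans (le_of_eq ?_) h1
      have h2 : √(2 * (pullCount A t a * m a) * Real.log (1 / δ)) =
          pullCount A t a * √(2 * m a * (Real.log (1 / δ) / pullCount A t a)) := by
        rw [Real.sqrt_eq_iff_mul_self_eq (by positivity) (by positivity)]
        rw [mul_mul_mul_comm, Real.mul_self_sqrt (by positivity)]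
        field_simp
      rw [h2]
      ring

theorem sampleMean_sub_rad_le (hL : 1 ≤ Real.log (1 / δ))
    (hdev : UpperDev A T x m (Real.log (1 / δ))) (hm : ∀ a, m a ∈ Set.Icc (0 : ℝ) 1)
    {t : ℕ} (ht : t ∈ Finset.Icc 1 T) (a : 𝒜) :
    max (sampleMean A x t a -
      rad (sampleMean A x t a) (max (pullCount A t a) 1 : ℕ) δ) 0 ≤ m a := by
  refine max_le ?_ (hm a).1
  rw [rad_eq]
  by_cases hn : pullCount A t a = 0
  · rw [sampleMean_of_pullCount_eq_zero hn, hn]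
    simp only [zero_sub, mul_zero, zero_mul, Real.sqrt_zero]
    norm_num
    linarith [(hm a).1, one_div δ ▸ hL, Real.log_inv δ]
  · have hn1 : max (pullCount A t a) 1 = pullCount A t a := by omega
    have hnpos : (0 : ℝ) < pullCount A t a := by exact_mod_cast Nat.pos_of_ne_zero hn
    have hy : 0 ≤ Real.log (1 / δ) / pullCount A t a := by positivity
    have h1 := hdev a _ (pullCount_mem ht hn) (armSum_pullCount_one A a ht)
    have hma := (hm a).1
    rw [sampleMean_eq ht, hn1]
    refine sub_sqrt_le_of_le_add_sqrt hy ?_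
    rw [div_le_iff₀ hnpos]
    refine le_trans h1 (le_of_eq ?_)
    have h2 : √(2 * (pullCount A t a * m a) * Real.log (1 / δ)) =
        pullCount A t a * √(2 * m a * (Real.log (1 / δ) / pullCount A t a)) := by
      rw [Real.sqrt_eq_iff_mul_self_eq (by positivity) (by positivity)]
      rw [mul_mul_mul_comm, Real.mul_self_sqrt (by positivity)]
      field_simp
    rw [h2]
    field_simp

variable {q : ℕ → ℝ} {qhi : ℝ}

/-- With y = log(1/δ)/N, the constants bound (1 + γ)((1 + γ)m + 3y/γ) + 5y/γ for γ ≤ 1. The lower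
counterpart comes from (1 - γ)((1 - γ)m - 3y/γ) - 5y/γ. -/
theorem sampleMean_add_rad_le (h0 : 0 < γ) (h1 : γ ≤ 1) (hL : 1 ≤ Real.log (1 / δ))
    (hdev : MultDev A T q qhi x m γ (3 * Real.log (1 / δ))) (hm : ∀ a, m a ∈ Set.Icc (0 : ℝ) 1)
    (hx : ∀ s ∈ Finset.Icc 1 T, 0 ≤ x s) {t : ℕ} (ht : t ∈ Finset.Icc 1 T) (a : 𝒜) :
    min (sampleMean A x t a +
      rad (sampleMean A x t a) (max (pullCount A t a) 1 : ℕ) δ) 1 ≤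
      (1 + 3 * γ) * m a + 11 / γ * (Real.log (1 / δ) / (max (pullCount A t a) 1 : ℕ)) := by
  have hma := (hm a).1
  by_cases hn : pullCount A t a = 0
  · refine (min_le_right _ _).trans ?_
    have h2 : 1 ≤ 11 / γ := by rw [le_div_iff₀ h0]; linarith
    rw [hn]
    norm_num only [max_eq_right, Nat.cast_one, div_one, zero_le]
    have h3 : 0 ≤ (1 + 3 * γ) * m a := by positivity
    nlinarith
  · refine (min_le_left _ _).trans ?_
    have h2 := sampleMean_nonneg (A := A) hx ht a
    have hn1 : max (pullCount A t a) 1 = pullCount A t a := by omega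
    have hnpos : (0 : ℝ) < pullCount A t a := by exact_mod_cast Nat.pos_of_ne_zero hn
    have hy : 0 ≤ Real.log (1 / δ) / pullCount A t a := by positivity
    have h3 := hdev.arm_le a _ (pullCount_mem ht hn) (armSum_pullCount_one A a ht)
    rw [rad_eq, hn1]
    have h4 := sqrt_add_le_mul_add h2 hy h0 h1
    set y := Real.log (1 / δ) / pullCount A t a with hydef
    have h5 : sampleMean A x t a ≤ (1 + γ) * m a + 3 * (y / γ) := by
      rw [sampleMean_eq ht, hn1, div_le_iff₀ hnpos]
      refine h3.trans (le_of_eq ?_)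
      rw [hydef]
      field_simp
    have h6 : 11 / γ * y = 11 * (y / γ) := by ring
    rw [h6]
    have h7 : 0 ≤ y / γ := by positivity
    nlinarith [mul_le_mul_of_nonneg_left h5 h0.le, mul_nonneg h0.le hma, mul_nonneg h7 h0.le]

theorem le_sampleMean_sub_rad (h0 : 0 < γ) (h1 : γ ≤ 1) (hL : 1 ≤ Real.log (1 / δ))
    (hdev : MultDev A T q qhi x m γ (3 * Real.log (1 / δ))) (hm : ∀ a, m a ∈ Set.Icc (0 : ℝ) 1)
    (hx : ∀ s ∈ Finset.Icc 1 T, 0 ≤ x s) {t : ℕ} (ht : t ∈ Finset.Icc 1 T) (a : 𝒜) :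
    (1 - 2 * γ) * m a - 8 / γ * (Real.log (1 / δ) / (max (pullCount A t a) 1 : ℕ)) ≤
      max (sampleMean A x t a -
        rad (sampleMean A x t a) (max (pullCount A t a) 1 : ℕ) δ) 0 := by
  have hma := (hm a).1
  by_cases hn : pullCount A t a = 0
  · refine le_trans ?_ (le_max_right _ _)
    have h2 : 1 ≤ 8 / γ := by rw [le_div_iff₀ h0]; linarith
    rw [hn]
    norm_num only [max_eq_right, Nat.cast_one, div_one, zero_le]
    nlinarith [(hm a).2, mul_nonneg h0.le hma]
  · refine le_trans ?_ (le_max_left _ _)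
    have h2 := sampleMean_nonneg (A := A) hx ht a
    have hn1 : max (pullCount A t a) 1 = pullCount A t a := by omega
    have hnpos : (0 : ℝ) < pullCount A t a := by exact_mod_cast Nat.pos_of_ne_zero hn
    have hy : 0 ≤ Real.log (1 / δ) / pullCount A t a := by positivity
    have h3 := hdev.le_arm a _ (pullCount_mem ht hn) (armSum_pullCount_one A a ht)
    rw [rad_eq, hn1]
    have h4 := sqrt_add_le_mul_add h2 hy h0 h1
    set y := Real.log (1 / δ) / pullCount A t a with hydef
    have h5 : (1 - γ) * m a - 3 * (y / γ) ≤ sampleMean A x t a := by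
      rw [sampleMean_eq ht, hn1, le_div_iff₀ hnpos]
      refine le_trans (le_of_eq ?_) h3
      rw [hydef]
      field_simp
    have h6 : 8 / γ * y = 8 * (y / γ) := by ring
    rw [h6]
    have h7 : 0 ≤ y / γ := by positivity
    nlinarith [mul_le_mul_of_nonneg_left h5 (sub_nonneg.2 h1), mul_nonneg (mul_nonneg h0.le h0.le) hma,
      mul_nonneg h7 h0.le]

/-- Grouping rounds by arm in a sum of functions of the pull count. -/
theorem sum_comp_pullCount [Fintype 𝒜] (A : ℕ → 𝒜) (f : ℕ → ℝ) (n : ℕ) :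
    ∑ s ∈ Finset.Icc 1 n, f (pullCount A s (A s)) =
      ∑ a, ∑ k ∈ Finset.range (pullCount A (n + 1) a), f k := by
  induction n with
  | zero => simp [pullCount]
  | succ n ih =>
    rw [Finset.sum_Icc_succ_top (by omega), ih]
    have h : ∀ a, ∑ k ∈ Finset.range (pullCount A (n + 1 + 1) a), f k =
        ∑ k ∈ Finset.range (pullCount A (n + 1) a), f k +
          if A (n + 1) = a then f (pullCount A (n + 1) a) else 0 := by
      intro a
      rw [pullCount_succ A a (by omega : 1 ≤ n + 1)]
      split_ifs with h
      · rw [Finset.sum_range_succ]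
      · simp
    simp only [h, Finset.sum_add_distrib, Finset.sum_ite_eq, Finset.mem_univ, if_true]

/-- The index k = 0 contributes 1 because of the maximum; the other terms form a harmonic sum. -/
theorem sum_range_inv_max_le {n T : ℕ} (hn : n ≤ T) :
    ∑ k ∈ Finset.range n, (1 : ℝ) / (max k 1 : ℕ) ≤ 2 + Real.log T := by
  have hlog : 0 ≤ Real.log T := Real.log_natCast_nonneg T
  cases n with
  | zero => simp; linarith
  | succ n =>
    rw [Finset.sum_range_succ']
    have h1 : ∑ k ∈ Finset.range n, (1 : ℝ) / (max (k + 1) 1 : ℕ) = (harmonic n : ℝ) := by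
      rw [harmonic]
      push_cast
      refine Finset.sum_congr rfl fun k _ => ?_
      have : ((1 : ℝ) ≤ (k : ℝ) + 1) := by linarith [Nat.cast_nonneg (α := ℝ) k]
      rw [max_eq_left this, one_div]
    have h2 := harmonic_le_one_add_log n
    have h3 : Real.log n ≤ Real.log T := by
      rcases Nat.eq_zero_or_pos n with h | h
      · simpa [h] using hlog
      · exact Real.log_le_log (by exact_mod_cast h) (by exact_mod_cast (by omega : n ≤ T))
    rw [h1]
    norm_num
    linarith

theorem sum_inv_pulls_le [Fintype 𝒜] (A : ℕ → 𝒜) {n : ℕ} (hn : n ≤ T) :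
    ∑ s ∈ Finset.Icc 1 n, (1 : ℝ) / (max (pullCount A s (A s)) 1 : ℕ) ≤
      Fintype.card 𝒜 * (2 + Real.log T) := by
  rw [sum_comp_pullCount A (fun k => (1 : ℝ) / (max k 1 : ℕ)) n]
  refine (Finset.sum_le_card_nsmul _ _ (2 + Real.log T) fun a _ => ?_).trans (by simp [mul_add])
  have := pullCount_lt A a (by omega : 1 ≤ n + 1)
  exact sum_range_inv_max_le (by omega)

end SampleMeans

/-! ### Elementary bounds for the instance, its linear program and the stopping time -/

namespace Instance

variable {𝒜 : Type*} {d : ℕ} (I : Instance 𝒜 d)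

theorem one_mem : 1 ∈ Finset.Icc 1 I.T := Finset.mem_Icc.2 ⟨le_rfl, I.one_le_T⟩

theorem T_pos : (0 : ℝ) < I.T := by exact_mod_cast I.one_le_T

theorem B_pos : 0 < I.B := mul_pos I.b_pos I.T_pos

theorem Q_pos : 0 < I.Q := Finset.sum_pos (fun _ ht => I.q_pos ht) ⟨1, I.one_mem⟩

theorem r_mem (a : 𝒜) : I.r a ∈ Set.Icc (0 : ℝ) 1 := (isCoordinate_reward I).mean_mem a

theorem c_mem (a : 𝒜) (i : Fin d) : I.c a i ∈ Set.Icc (0 : ℝ) 1 :=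
  (isCoordinate_consumption I i).mean_mem a

theorem exists_optimal [Fintype 𝒜] :
    ∃ u : 𝒜 → ℝ, (∀ a, 0 ≤ u a) ∧ ∑ a, u a = 1 ∧ (∀ i, I.Q * ∑ a, I.c a i * u a ≤ I.B) ∧
      I.Q * ∑ a, I.r a * u a = I.optLP := by
  obtain ⟨u, hu, h⟩ := (isGreatest_optLP I).1
  exact ⟨u, hu.1.1, hu.1.2, hu.2, h⟩

theorem optLP_nonneg [Fintype 𝒜] : 0 ≤ I.optLP := by
  obtain ⟨u, h0, -, -, h⟩ := I.exists_optimal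
  rw [← h]
  exact mul_nonneg I.Q_pos.le (Finset.sum_nonneg fun a _ => mul_nonneg (I.r_mem a).1 (h0 a))

theorem optLP_le_Q [Fintype 𝒜] : I.optLP ≤ I.Q := by
  obtain ⟨u, h0, h1, -, h⟩ := I.exists_optimal
  rw [← h]
  refine mul_le_of_le_one_right I.Q_pos.le ?_
  rw [← h1]
  exact Finset.sum_le_sum fun a _ => mul_le_of_le_one_left (h0 a) (I.r_mem a).2

theorem pred_mem {F : Oracle} (hF : I.IsOracle F) {t : ℕ} (ht : t ∈ Finset.Icc 1 I.T) :
    I.pred F t ∈ Set.Icc (I.qlo * I.T) (I.qhi * I.T) := by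
  refine hF t ht _ fun s => I.q_mem _ ?_
  have := Finset.mem_Icc.1 ht
  have := s.2
  exact Finset.mem_Icc.2 ⟨by omega, by omega⟩

theorem pred_pos {F : Oracle} (hF : I.IsOracle F) {t : ℕ} (ht : t ∈ Finset.Icc 1 I.T) :
    0 < I.pred F t :=
  (mul_pos I.qlo_pos I.T_pos).trans_le (I.pred_mem hF ht).1

theorem stopTime_mem (h : Trajectory 𝒜 d) :
    I.stopTime h = I.T + 1 ∨ (I.stopTime h ∈ Finset.Icc 1 I.T ∧
      ∃ i, I.B < ∑ s ∈ Finset.Icc 1 (I.stopTime h), I.q s * h.C s i) := by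
  have := Nat.sInf_mem (s := insert (I.T + 1)
    {t | t ∈ Finset.Icc 1 I.T ∧ ∃ i, I.B < ∑ s ∈ Finset.Icc 1 t, I.q s * h.C s i}) ⟨_, Or.inl rfl⟩
  exact this

end Instance

/-! ### The costs of OA-UCB and the comparison within one round -/

section Deterministic

variable {𝒜 : Type*} {d : ℕ} {I : Instance 𝒜 d} {F : Oracle} {δ : ℝ} {h : Trajectory 𝒜 d}

section Cost

variable [DecidableEq 𝒜]

theorem lcb_castSucc (h : Trajectory 𝒜 d) (δ : ℝ) (t : ℕ) (a : 𝒜) (i : Fin d) :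
    h.lcb δ t a i.castSucc = max (h.meanC t a i - rad (h.meanC t a i) (h.pulls t a) δ) 0 := by
  rw [Trajectory.lcb, Fin.snoc_castSucc]

theorem lcb_last (h : Trajectory 𝒜 d) (δ : ℝ) (t : ℕ) (a : 𝒜) :
    h.lcb δ t a (Fin.last d) = 0 := by
  rw [Trajectory.lcb, Fin.snoc_last]

theorem beta_castSucc (i : Fin d) : beta i.castSucc = 1 := by
  rw [beta, Fin.snoc_castSucc]

theorem beta_last : beta (Fin.last d) = 0 := by
  rw [beta, Fin.snoc_last]

theorem beta_mem (j : Fin (d + 1)) : beta j ∈ Set.Icc (0 : ℝ) 1 := by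
  refine Fin.lastCases ?_ (fun i => ?_) j
  · simp [beta_last]
  · simp [beta_castSucc]

theorem lcb_nonneg (h : Trajectory 𝒜 d) (δ : ℝ) (t : ℕ) (a : 𝒜) (j : Fin (d + 1)) :
    0 ≤ h.lcb δ t a j := by
  refine Fin.lastCases ?_ (fun i => ?_) j
  · rw [lcb_last]
  · rw [lcb_castSucc]
    exact le_max_right _ _

theorem cost_eq (hF : I.IsOracle F) {t : ℕ} (ht : t ∈ Finset.Icc 1 I.T) (j : Fin (d + 1)) :
    cost I F δ h t j = I.q t * beta j - I.q t * I.pred F t / I.B * h.lcb δ t (h.A t) j := by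
  have h1 := (I.pred_pos hF ht).ne'
  have h2 := I.B_pos.ne'
  rw [cost]
  field_simp

theorem cost_last (hF : I.IsOracle F) {t : ℕ} (ht : t ∈ Finset.Icc 1 I.T) :
    cost I F δ h t (Fin.last d) = 0 := by
  rw [cost_eq hF ht, beta_last, lcb_last]
  ring

theorem lcb_one (hL : 0 ≤ Real.log (1 / δ)) (a : 𝒜) (j : Fin (d + 1)) : h.lcb δ 1 a j = 0 := by
  refine Fin.lastCases ?_ (fun i => ?_) j
  · rw [lcb_last]
  · rw [lcb_castSucc]
    have h1 : h.meanC 1 a i = 0 := by simp [Trajectory.meanC]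
    have h2 : (h.pulls 1 a : ℝ) = 1 := by simp [Trajectory.pulls]
    rw [h1, h2, rad]
    refine max_eq_right ?_
    rw [mul_zero, zero_mul, zero_div, Real.sqrt_zero]
    linarith

/-- In the first round the costs are `q 1` on the resources and `0` on the null resource, so that
the first mixability gap is positive. -/
theorem rho_cost_pos (hF : I.IsOracle F) (hL : 0 ≤ Real.log (1 / δ)) :
    0 < rho (cost I F δ h) 0 1 := by
  have hq := I.q_pos I.one_mem
  have h1 : ∀ j, cost I F δ h 1 j = I.q 1 * beta j := fun j => by
    rw [cost_eq hF I.one_mem, lcb_one hL]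
    ring
  have h2 : (⨅ j, cost I F δ h 1 j) ≤ 0 :=
    (ciInf_le (Set.finite_range _).bddBelow (Fin.last d)).trans (cost_last hF I.one_mem).le
  have h3 : 0 < ∑ j, cost I F δ h 1 j * weights (cost I F δ h) 0 1 j := by
    simp only [h1]
    refine Finset.sum_pos' (fun j _ => mul_nonneg (mul_nonneg hq.le (beta_mem j).1)
      (weights_nonneg _ _ _ _)) ⟨Fin.castSucc ⟨0, I.one_le_d⟩, Finset.mem_univ _, ?_⟩
    rw [beta_castSucc, weights, if_pos le_rfl]
    positivity
  rw [rho, if_pos rfl]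
  linarith

/-- AdaHedge on the costs of OA-UCB. -/
theorem cost_regret (hF : I.IsOracle F) (hL : 0 ≤ Real.log (1 / δ)) {n : ℕ} (hn : n ≤ I.T)
    (hl : ∀ t ∈ Finset.Icc 1 I.T, ∀ a i, h.lcb δ t a (Fin.castSucc i) ≤ I.c a i)
    (j : Fin (d + 1)) :
    ∑ t ∈ Finset.Icc 1 n, ∑ j, cost I F δ h t j * scalarization I F δ h t j ≤
      ∑ t ∈ Finset.Icc 1 n, cost I F δ h t j +
        4 * ((I.qhi + I.qhi ^ 2 / I.b) * √(n * Real.log ((d : ℝ) + 1))) := by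
  have hb := I.b_pos
  have hT := I.T_pos
  have hsub : ∀ t ∈ Finset.Icc 1 n, t ∈ Finset.Icc 1 I.T := fun t ht =>
    Finset.Icc_subset_Icc_right hn ht
  have hlcb : ∀ t ∈ Finset.Icc 1 I.T, ∀ a j, h.lcb δ t a j ≤ 1 := fun t ht a j => by
    refine Fin.lastCases ?_ (fun i => ?_) j
    · rw [lcb_last]
      exact zero_le_one
    · exact (hl t ht a i).trans (I.c_mem a i).2
  -- The costs lie in [-q_t Q̂_t/B, q_t]. As Q̂_t ≤ q̄T and B = bT, this interval is no longer than
  -- q̄ + q̄²/b.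
  refine adaHedge_regret I.one_le_d (rho_cost_pos hF hL)
    (lo := fun t => -(I.q t * I.pred F t / I.B)) (by have := I.qhi_pos; positivity) n ?_ ?_ j
  · intro t ht j
    have ht := hsub t ht
    rw [cost_eq hF ht]
    have h1 : 0 ≤ I.q t * beta j := mul_nonneg (I.q_pos ht).le (beta_mem j).1
    have h2 : 0 ≤ I.q t * I.pred F t / I.B :=
      div_nonneg (mul_nonneg (I.q_pos ht).le (I.pred_pos hF ht).le) I.B_pos.le
    have := mul_le_of_le_one_right h2 (hlcb t ht (h.A t) j)
    linarith
  · intro t ht j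
    have ht := hsub t ht
    rw [cost_eq hF ht]
    have hq := I.q_pos ht
    have h1 : I.q t * beta j ≤ I.qhi :=
      (mul_le_of_le_one_right hq.le (beta_mem j).2).trans (I.q_mem t ht).2
    have h2 : 0 ≤ I.q t * I.pred F t / I.B :=
      div_nonneg (mul_nonneg hq.le (I.pred_pos hF ht).le) I.B_pos.le
    have h3 : I.q t * I.pred F t / I.B ≤ I.qhi ^ 2 / I.b := by
      calc _ ≤ I.qhi * (I.qhi * I.T) / I.B := by
            refine div_le_div_of_nonneg_right ?_ I.B_pos.le
            exact mul_le_mul (I.q_mem t ht).2 (I.pred_mem hF ht).2 (I.pred_pos hF ht).le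
              I.qhi_pos.le
        _ = _ := by
            rw [Instance.B]
            field_simp
    have := mul_nonneg h2 (lcb_nonneg h δ t (h.A t) j)
    linarith

end Cost

variable [Fintype 𝒜] [DecidableEq 𝒜]

/-- The comparison of the played action with the optimal mixture in one round. -/
theorem round_bound (hF : I.IsOracle F) {ε : ℝ} {t : ℕ} (ht : t ∈ Finset.Icc 1 I.T)
    (hε : |I.pred F t - I.Q| ≤ ε)
    (hmax : ∀ a, score I F δ h t a ≤ score I F δ h t (h.A t))
    (hu : ∀ a, I.r a ≤ h.ucb δ t a) (hl : ∀ a i, h.lcb δ t a (Fin.castSucc i) ≤ I.c a i) :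
    I.q t * (I.optLP / I.Q) ≤ I.q t * h.ucb δ t (h.A t) +
      ∑ j, cost I F δ h t j * scalarization I F δ h t j + I.q t * ε / I.Q := by
  obtain ⟨u, u0, u1, uc, ur⟩ := I.exists_optimal
  have hQ := I.Q_pos
  have hB := I.B_pos
  have hq := I.q_pos ht
  have hp := I.pred_pos hF ht
  set p := I.pred F t with hpdef
  set μ := scalarization I F δ h t with hμ
  have hμ0 : ∀ j, 0 ≤ μ j := fun j => weights_nonneg _ _ _ _
  have hμ1 : ∑ j, μ j = 1 := sum_weights _ _ _
  have h1 : ∑ a, u a * score I F δ h t a ≤ score I F δ h t (h.A t) := by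
    calc _ ≤ ∑ a, u a * score I F δ h t (h.A t) :=
          Finset.sum_le_sum fun a _ => mul_le_mul_of_nonneg_left (hmax a) (u0 a)
      _ = _ := by rw [← Finset.sum_mul, u1, one_mul]
  -- Lower bounds do not exceed the mean consumptions, so the optimal mixture stays feasible for
  -- them.
  have h2 : ∀ j, ∑ a, u a * h.lcb δ t a j ≤ I.B / I.Q * beta j := by
    intro j
    refine Fin.lastCases ?_ (fun i => ?_) j
    · simp [lcb_last, beta_last]
    · rw [beta_castSucc, mul_one, le_div_iff₀ hQ, mul_comm]
      refine le_trans (mul_le_mul_of_nonneg_left (Finset.sum_le_sum fun a _ => ?_) hQ.le) (uc i)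
      rw [mul_comm]
      exact mul_le_mul_of_nonneg_right (hl a i) (u0 a)
  have h3 : ∑ a, u a * score I F δ h t a =
      ∑ a, u a * h.ucb δ t a - p / I.B * ∑ j, μ j * ∑ a, u a * h.lcb δ t a j := by
    have : ∑ j, μ j * ∑ a, u a * h.lcb δ t a j = ∑ a, u a * ∑ j, μ j * h.lcb δ t a j := by
      simp only [Finset.mul_sum]
      rw [Finset.sum_comm]
      exact Finset.sum_congr rfl fun a _ => Finset.sum_congr rfl fun j _ => by ring
    rw [this, Finset.mul_sum, ← Finset.sum_sub_distrib]
    refine Finset.sum_congr rfl fun a _ => ?_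
    rw [score]
    ring
  have h4 : I.optLP / I.Q ≤ ∑ a, u a * h.ucb δ t a := by
    rw [← ur, mul_div_cancel_left₀ _ hQ.ne']
    refine Finset.sum_le_sum fun a _ => ?_
    rw [mul_comm]
    exact mul_le_mul_of_nonneg_left (hu a) (u0 a)
  set mb := ∑ j, μ j * beta j with hmb
  have hmb0 : 0 ≤ mb := Finset.sum_nonneg fun j _ => mul_nonneg (hμ0 j) (beta_mem j).1
  have hmb1 : mb ≤ 1 := by
    rw [← hμ1]
    exact Finset.sum_le_sum fun j _ => mul_le_of_le_one_right (hμ0 j) (beta_mem j).2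
  have h5 : ∑ j, μ j * ∑ a, u a * h.lcb δ t a j ≤ I.B / I.Q * mb := by
    rw [hmb, Finset.mul_sum]
    refine Finset.sum_le_sum fun j _ => ?_
    refine (mul_le_mul_of_nonneg_left (h2 j) (hμ0 j)).trans (le_of_eq ?_)
    ring
  have h6 : p / I.B * ∑ j, μ j * ∑ a, u a * h.lcb δ t a j ≤ p / I.Q * mb := by
    refine (mul_le_mul_of_nonneg_left h5 (by positivity)).trans (le_of_eq ?_)
    field_simp
  have h7 : ∑ j, cost I F δ h t j * μ j =
      I.q t * mb - I.q t * (p / I.B * ∑ j, μ j * h.lcb δ t (h.A t) j) := by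
    rw [hmb, Finset.mul_sum, Finset.mul_sum, Finset.mul_sum, ← Finset.sum_sub_distrib]
    refine Finset.sum_congr rfl fun j _ => ?_
    rw [cost_eq hF ht]
    ring
  -- Replacing the prediction by Q costs only ε/Q because the weight of the proper resources is at
  -- most 1.
  have h8 : p / I.Q * mb ≤ mb + ε / I.Q := by
    have : p / I.Q * mb = mb + (p - I.Q) / I.Q * mb := by field_simp; ring
    rw [this]
    have h9 : (p - I.Q) / I.Q ≤ ε / I.Q := by
      have := (abs_le.1 hε).2
      gcongr
    have h10 : 0 ≤ ε / I.Q := div_nonneg ((abs_nonneg _).trans hε) hQ.le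
    nlinarith
  have h11 : score I F δ h t (h.A t) =
      h.ucb δ t (h.A t) - p / I.B * ∑ j, μ j * h.lcb δ t (h.A t) j := rfl
  have h12 : I.optLP / I.Q ≤ h.ucb δ t (h.A t) -
      p / I.B * ∑ j, μ j * h.lcb δ t (h.A t) j + mb + ε / I.Q := by linarith
  have h13 := mul_le_mul_of_nonneg_left h12 hq.le
  rw [h7, mul_div_assoc]
  linarith

end Deterministic

theorem one_le_card {𝒜 : Type*} [Fintype 𝒜] {d : ℕ} (I : Instance 𝒜 d) :
    (1 : ℝ) ≤ Fintype.card 𝒜 := by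
  exact_mod_cast Fintype.card_pos_iff.2 ⟨I.nullAction⟩

/-- Puts the additive error 3q̄L/γ of the weighted sums below the level γV at which γ is tuned. -/
theorem qhi_mul_le {𝒜 : Type*} [Fintype 𝒜] {d : ℕ} (I : Instance 𝒜 d) {L : ℝ} (hL : 1 ≤ L) :
    I.qhi * L ≤ I.qhi * Fintype.card 𝒜 * L ^ 2 := by
  have hq := I.qhi_pos
  have hK := one_le_card I
  have h1 : I.qhi * L ≤ I.qhi * L * Fintype.card 𝒜 := le_mul_of_one_le_right (by positivity) hK
  have h2 : I.qhi * L * Fintype.card 𝒜 ≤ I.qhi * L * Fintype.card 𝒜 * L :=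
    le_mul_of_one_le_right (by positivity) hL
  linarith

/-! ### The regret on the favourable event -/

section Regret

variable {𝒜 : Type*} [Fintype 𝒜] [DecidableEq 𝒜] {d : ℕ} {I : Instance 𝒜 d} {F : Oracle}
  {δ γ : ℝ} {h : Trajectory 𝒜 d}

/-- The inverse pull counts of each arm form a harmonic sum, at most 2 + log T ≤ 2L. This is the
quantity that γ²V is matched with. -/
theorem sum_q_mul_div_pulls_le (I : Instance 𝒜 d) (A : ℕ → 𝒜) {L : ℝ} (hL : 1 ≤ L)
    (hlog : 2 + Real.log I.T ≤ 2 * L) {n : ℕ} (hn : n ≤ I.T) :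
    ∑ t ∈ Finset.Icc 1 n, I.q t * (L / (max (pullCount A t (A t)) 1 : ℕ)) ≤
      2 * (I.qhi * Fintype.card 𝒜 * L ^ 2) := by
  have hq := I.qhi_pos
  calc _ ≤ ∑ t ∈ Finset.Icc 1 n,
        I.qhi * L * ((1 : ℝ) / (max (pullCount A t (A t)) 1 : ℕ)) := by
        refine Finset.sum_le_sum fun t ht => ?_
        have h1 := (I.q_mem t (Finset.Icc_subset_Icc_right hn ht)).2
        rw [mul_assoc, mul_one_div]
        exact mul_le_mul_of_nonneg_right h1 (by positivity)
    _ ≤ I.qhi * L * (Fintype.card 𝒜 * (2 * L)) := by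
        rw [← Finset.mul_sum]
        gcongr
        exact (sum_inv_pulls_le A hn).trans (by gcongr)
    _ = _ := by ring

/-- The optimistic consumption is close to the budget if the resource is overdrawn in
round `n + 1`. -/
theorem le_sum_lcb (h0 : 0 < γ) (h4 : γ ≤ 1 / 4) (hL : 1 ≤ Real.log (1 / δ))
    (hlog : 2 + Real.log I.T ≤ 2 * Real.log (1 / δ))
    (hγ : I.qhi * Fintype.card 𝒜 * Real.log (1 / δ) ^ 2 = γ ^ 2 * I.B) {i : Fin d}
    (hC : ∀ s ∈ Finset.Icc 1 I.T, h.C s i ∈ Set.Icc (0 : ℝ) 1)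
    (hdev : MultDev h.A I.T I.q I.qhi (fun s => h.C s i) (fun a => I.c a i) γ
      (3 * Real.log (1 / δ))) {n : ℕ} (hn : n + 1 ≤ I.T)
    (hover : I.B < ∑ s ∈ Finset.Icc 1 (n + 1), I.q s * h.C s i) :
    I.B * (1 - 23 * γ) ≤ ∑ t ∈ Finset.Icc 1 n, I.q t * h.lcb δ t (h.A t) i.castSucc := by
  have hB := I.B_pos
  have hq := I.qhi_pos
  set L := Real.log (1 / δ) with hLdef
  set X := ∑ t ∈ Finset.Icc 1 n, I.q t * I.c (h.A t) i with hX
  have hsub : ∀ t ∈ Finset.Icc 1 n, t ∈ Finset.Icc 1 I.T := fun t ht =>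
    Finset.Icc_subset_Icc_right (by omega) ht
  have hX0 : 0 ≤ X := Finset.sum_nonneg fun t ht =>
    mul_nonneg (I.q_pos (hsub t ht)).le (I.c_mem _ _).1
  have hLq : I.qhi * L ≤ γ ^ 2 * I.B := hγ ▸ qhi_mul_le I hL
  have h1 : (1 - 2 * γ) * X - 16 * γ * I.B ≤
      ∑ t ∈ Finset.Icc 1 n, I.q t * h.lcb δ t (h.A t) i.castSucc := by
    calc (1 - 2 * γ) * X - 16 * γ * I.B
        ≤ (1 - 2 * γ) * X - 8 / γ * ∑ t ∈ Finset.Icc 1 n,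
            I.q t * (L / (max (pullCount h.A t (h.A t)) 1 : ℕ)) := by
          have h2 := mul_le_mul_of_nonneg_left (sum_q_mul_div_pulls_le I h.A hL hlog (n := n)
            (by omega)) (show 0 ≤ 8 / γ by positivity)
          rw [hγ] at h2
          have h3 : 8 / γ * (2 * (γ ^ 2 * I.B)) = 16 * γ * I.B := by field_simp; ring
          linarith
      _ = ∑ t ∈ Finset.Icc 1 n, I.q t * ((1 - 2 * γ) * I.c (h.A t) i -
            8 / γ * (L / (max (pullCount h.A t (h.A t)) 1 : ℕ))) := by
          rw [hX, Finset.mul_sum, Finset.mul_sum, ← Finset.sum_sub_distrib]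
          exact Finset.sum_congr rfl fun t _ => by ring
      _ ≤ _ := by
          refine Finset.sum_le_sum fun t ht =>
            mul_le_mul_of_nonneg_left ?_ (I.q_pos (hsub t ht)).le
          rw [lcb_castSucc]
          exact le_sampleMean_sub_rad h0 (by linarith) hL hdev (fun a => I.c_mem a i)
            (fun s hs => (hC s hs).1) (hsub t ht) (h.A t)
  have h2 : ∑ s ∈ Finset.Icc 1 n, I.q s * h.C s i ≤ (1 + γ) * X + 3 * γ * I.B := by
    rcases Nat.eq_zero_or_pos n with hn0 | hn0
    · have : 0 ≤ (1 + γ) * X + 3 * γ * I.B := by positivity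
      simpa [hn0] using this
    · have h3 := hdev.sum_le n (Finset.mem_Icc.2 ⟨hn0, by omega⟩)
      have h5 : 3 * L * I.qhi / γ ≤ 3 * γ * I.B := by
        rw [div_le_iff₀ h0]
        linarith
      linarith
  have h3 : I.q (n + 1) * h.C (n + 1) i ≤ γ ^ 2 * I.B := by
    have hm : n + 1 ∈ Finset.Icc 1 I.T := Finset.mem_Icc.2 ⟨by omega, hn⟩
    have h5 := mul_le_of_le_one_right (I.q_pos hm).le (hC _ hm).2
    have h6 := (I.q_mem _ hm).2
    have h7 : I.qhi ≤ I.qhi * L := le_mul_of_one_le_right hq.le hL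
    linarith
  rw [Finset.sum_Icc_succ_top (by omega)] at hover
  have h5 : γ ^ 2 * I.B ≤ 1 / 4 * γ * I.B := by
    have : γ ^ 2 ≤ 1 / 4 * γ := by nlinarith
    gcongr
  have hγB : 0 ≤ γ * I.B := by positivity
  -- The overdraft gives B ≤ (1 + γ)X + 3γB + γ²B with γ² ≤ γ/4. Multiplying by 1 - γ gives X ≥ B(1
  -- - 5γ), and the final 23 is 2 + 5 + 16.
  have h6 : I.B * (1 - 13 / 4 * γ) ≤ (1 + γ) * X := by linarith
  have h7 : I.B * (1 - 5 * γ) ≤ X := by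
    have h8 := mul_le_mul_of_nonneg_left h6 (show 0 ≤ 1 - γ by linarith)
    nlinarith [mul_nonneg (sq_nonneg γ) hX0, mul_nonneg (sq_nonneg γ) hB.le]
  have h8 := mul_le_mul_of_nonneg_left h7 (show 0 ≤ 1 - 2 * γ by linarith)
  nlinarith [mul_nonneg (sq_nonneg γ) hB.le]

/-- The optimistic rewards exceed the collected rewards by little. -/
theorem sum_ucb_le {V : ℝ} (hV : 0 ≤ V) (h0 : 0 < γ) (h4 : γ ≤ 1 / 4)
    (hL : 1 ≤ Real.log (1 / δ)) (hlog : 2 + Real.log I.T ≤ 2 * Real.log (1 / δ))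
    (hγ : I.qhi * Fintype.card 𝒜 * Real.log (1 / δ) ^ 2 = γ ^ 2 * V)
    (hR : ∀ s ∈ Finset.Icc 1 I.T, h.R s ∈ Set.Icc (0 : ℝ) 1)
    (hdev : MultDev h.A I.T I.q I.qhi h.R I.r γ (3 * Real.log (1 / δ))) {n : ℕ}
    (hn : n ≤ I.T) :
    (1 - 4 * γ) * ∑ t ∈ Finset.Icc 1 n, I.q t * h.ucb δ t (h.A t) - 25 * γ * V ≤
      ∑ t ∈ Finset.Icc 1 n, I.q t * h.R t := by
  have hq := I.qhi_pos
  set L := Real.log (1 / δ) with hLdef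
  set X := ∑ t ∈ Finset.Icc 1 n, I.q t * I.r (h.A t) with hX
  have hsub : ∀ t ∈ Finset.Icc 1 n, t ∈ Finset.Icc 1 I.T := fun t ht =>
    Finset.Icc_subset_Icc_right hn ht
  have hX0 : 0 ≤ X := Finset.sum_nonneg fun t ht =>
    mul_nonneg (I.q_pos (hsub t ht)).le (I.r_mem _).1
  have hLq : I.qhi * L ≤ γ ^ 2 * V := hγ ▸ qhi_mul_le I hL
  have h1 : ∑ t ∈ Finset.Icc 1 n, I.q t * h.ucb δ t (h.A t) ≤ (1 + 3 * γ) * X + 22 * γ * V := by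
    calc _ ≤ ∑ t ∈ Finset.Icc 1 n, I.q t * ((1 + 3 * γ) * I.r (h.A t) +
            11 / γ * (L / (max (pullCount h.A t (h.A t)) 1 : ℕ))) := by
          refine Finset.sum_le_sum fun t ht =>
            mul_le_mul_of_nonneg_left ?_ (I.q_pos (hsub t ht)).le
          exact sampleMean_add_rad_le h0 (by linarith) hL hdev I.r_mem
            (fun s hs => (hR s hs).1) (hsub t ht) (h.A t)
      _ = (1 + 3 * γ) * X + 11 / γ * ∑ t ∈ Finset.Icc 1 n,
            I.q t * (L / (max (pullCount h.A t (h.A t)) 1 : ℕ)) := by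
          rw [hX, Finset.mul_sum, Finset.mul_sum, ← Finset.sum_add_distrib]
          exact Finset.sum_congr rfl fun t _ => by ring
      _ ≤ _ := by
          have h2 := mul_le_mul_of_nonneg_left (sum_q_mul_div_pulls_le I h.A hL hlog hn)
            (show 0 ≤ 11 / γ by positivity)
          rw [hγ] at h2
          have h3 : 11 / γ * (2 * (γ ^ 2 * V)) = 22 * γ * V := by field_simp; ring
          linarith
  have h2 : (1 - γ) * X - 3 * γ * V ≤ ∑ s ∈ Finset.Icc 1 n, I.q s * h.R s := by
    rcases Nat.eq_zero_or_pos n with hn0 | hn0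
    · have h3 : X = 0 := by simp [hX, hn0]
      have h5 : 0 ≤ 3 * γ * V := by positivity
      rw [h3]
      simpa [hn0] using h5
    · have h3 := hdev.le_sum n (Finset.mem_Icc.2 ⟨hn0, hn⟩)
      have h5 : 3 * L * I.qhi / γ ≤ 3 * γ * V := by
        rw [div_le_iff₀ h0]
        linarith
      linarith
  -- (1 - 4γ)(1 + 3γ) ≤ 1 - γ matches the lower deviation of the collected rewards; 25 = 22 + 3.
  have h3 := mul_le_mul_of_nonneg_left h1 (show 0 ≤ 1 - 4 * γ by linarith)
  have h5 : 0 ≤ γ * V := by positivity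
  nlinarith [mul_nonneg (sq_nonneg γ) hX0, mul_nonneg (sq_nonneg γ) hV]

/-- Lower bound for the optimistic rewards collected before some resource is overdrawn. -/
theorem le_sum_ucb {ε : ℕ → ℝ} (hF : I.IsOracle F)
    (hε : ∀ t ∈ Finset.Icc 1 I.T, |I.pred F t - I.Q| ≤ ε t) (hL : 0 ≤ Real.log (1 / δ))
    (hA : FollowsOAUCB I F δ h)
    (hu : ∀ t ∈ Finset.Icc 1 I.T, ∀ a, I.r a ≤ h.ucb δ t a)
    (hl : ∀ t ∈ Finset.Icc 1 I.T, ∀ a i, h.lcb δ t a (Fin.castSucc i) ≤ I.c a i)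
    {s : ℝ} (hs : 0 ≤ s)
    (hZ : ∀ n i, n + 1 ≤ I.T → I.B < ∑ s ∈ Finset.Icc 1 (n + 1), I.q s * h.C s i →
      I.B * (1 - s) ≤ ∑ t ∈ Finset.Icc 1 n, I.q t * h.lcb δ t (h.A t) (Fin.castSucc i)) {n : ℕ}
    (hn : I.stopTime h = n + 1) (hnT : n ≤ I.T) :
    I.optLP - (s * I.optLP + (1 / I.Q + 1 / I.B) * ∑ t ∈ Finset.Icc 1 n, I.q t * ε t +
      4 * ((I.qhi + I.qhi ^ 2 / I.b) * √(n * Real.log ((d : ℝ) + 1)))) ≤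
      ∑ t ∈ Finset.Icc 1 n, I.q t * h.ucb δ t (h.A t) := by
  have hQ := I.Q_pos
  have hB := I.B_pos
  have hO := I.optLP_nonneg
  have hsub : ∀ t ∈ Finset.Icc 1 n, t ∈ Finset.Icc 1 I.T := fun t ht =>
    Finset.Icc_subset_Icc_right hnT ht
  set E := ∑ t ∈ Finset.Icc 1 n, I.q t * ε t with hE
  have hE0 : 0 ≤ E := Finset.sum_nonneg fun t ht =>
    mul_nonneg (I.q_pos (hsub t ht)).le ((abs_nonneg _).trans (hε t (hsub t ht)))
  set S := ∑ t ∈ Finset.Icc 1 n, I.q t with hS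
  set w := I.optLP / I.Q with hw
  have hw0 : 0 ≤ w := div_nonneg hO hQ.le
  have hw1 : w ≤ 1 := (div_le_one hQ).2 I.optLP_le_Q
  have hwQ : w * I.Q = I.optLP := div_mul_cancel₀ _ hQ.ne'
  set M := ∑ t ∈ Finset.Icc 1 n, ∑ j, cost I F δ h t j * scalarization I F δ h t j with hM
  set D := 4 * ((I.qhi + I.qhi ^ 2 / I.b) * √(n * Real.log ((d : ℝ) + 1))) with hD
  have h1 : S * w ≤ ∑ t ∈ Finset.Icc 1 n, I.q t * h.ucb δ t (h.A t) + M + E / I.Q := by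
    rw [hS, hM, hE, Finset.sum_mul, Finset.sum_div, ← Finset.sum_add_distrib,
      ← Finset.sum_add_distrib]
    refine Finset.sum_le_sum fun t ht => ?_
    have ht' := hsub t ht
    refine round_bound hF ht' (hε t ht') ((hA t ht').1 ?_) (hu t ht') (hl t ht')
    have := (Finset.mem_Icc.1 ht).2
    omega
  have hreg := cost_regret (h := h) (δ := δ) hF hL hnT hl
  have hlast : M ≤ D := by
    have h2 := hreg (Fin.last d)
    rw [Finset.sum_eq_zero fun t ht => cost_last hF (hsub t ht), zero_add] at h2
    exact h2
  have hEB : 0 ≤ E / I.B := by positivity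
  have hsplit : (1 / I.Q + 1 / I.B) * E = E / I.Q + E / I.B := by ring
  rw [hsplit]
  rcases I.stopTime_mem h with hτ | ⟨hmem, i, hi⟩
  · have hnT : n = I.T := by omega
    have h2 : S = I.Q := by rw [hS, hnT]; rfl
    rw [h2, mul_comm, hwQ] at h1
    have h3 : 0 ≤ s * I.optLP := mul_nonneg hs hO
    linarith
  · rw [hn] at hmem hi
    have hZ := hZ n i (Finset.mem_Icc.1 hmem).2 hi
    have h2 := hreg i.castSucc
    set Z := ∑ t ∈ Finset.Icc 1 n, I.q t * h.lcb δ t (h.A t) i.castSucc with hZdef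
    -- Replacing each prediction by Q costs ε_t/B, since lower bounds are at most 1.
    have h3 : ∑ t ∈ Finset.Icc 1 n, cost I F δ h t i.castSucc ≤ S - I.Q / I.B * Z + E / I.B := by
      rw [hS, hZdef, hE, Finset.mul_sum, Finset.sum_div, ← Finset.sum_sub_distrib,
        ← Finset.sum_add_distrib]
      refine Finset.sum_le_sum fun t ht => ?_
      have ht' := hsub t ht
      have hq := I.q_pos ht'
      have hl0 := lcb_nonneg h δ t (h.A t) i.castSucc
      have hl1 := (hl t ht' (h.A t) i).trans (I.c_mem _ _).2
      have he := (abs_le.1 (hε t ht')).1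
      have he0 := (abs_nonneg _).trans (hε t ht')
      rw [cost_eq hF ht', beta_castSucc, mul_one]
      have h5 : I.Q * h.lcb δ t (h.A t) i.castSucc ≤
          I.pred F t * h.lcb δ t (h.A t) i.castSucc + ε t := by nlinarith
      have h6 := mul_le_mul_of_nonneg_left h5 (show 0 ≤ I.q t / I.B by positivity)
      have h7 : I.q t / I.B * (I.Q * h.lcb δ t (h.A t) i.castSucc) =
        I.Q / I.B * (I.q t * h.lcb δ t (h.A t) i.castSucc) := by ring
      have h8 : I.q t / I.B * (I.pred F t * h.lcb δ t (h.A t) i.castSucc + ε t) =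
        I.q t * I.pred F t / I.B * h.lcb δ t (h.A t) i.castSucc + I.q t * ε t / I.B := by ring
      linarith
    have h4 : I.Q / I.B * (I.B * (1 - s)) ≤ I.Q / I.B * Z :=
      mul_le_mul_of_nonneg_left hZ (by positivity)
    have h5 : I.Q / I.B * (I.B * (1 - s)) = I.Q * (1 - s) := by field_simp
    -- The comparator puts weight w on the overdrawn resource and 1 - w on the null resource. The
    -- term wS then cancels against the left side of `h1`.
    have h6 : M ≤ w * (S - I.Q * (1 - s) + E / I.B + D) + (1 - w) * D := by
      have h7 : M ≤ S - I.Q * (1 - s) + E / I.B + D := by linarith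
      have h8 := mul_le_mul_of_nonneg_left h7 hw0
      have h9 := mul_le_mul_of_nonneg_left hlast (sub_nonneg.2 hw1)
      linarith
    have h7 : w * (E / I.B) ≤ E / I.B := mul_le_of_le_one_left hEB hw1
    have h8 : w * (I.Q * (1 - s)) = I.optLP * (1 - s) := by rw [← mul_assoc, hwQ]
    linarith

/-- The favourable event. -/
structure Concentrated (I : Instance 𝒜 d) (h : Trajectory 𝒜 d) (δ γr γc : ℝ) : Prop where
  reward_mem : ∀ s ∈ Finset.Icc 1 I.T, h.R s ∈ Set.Icc (0 : ℝ) 1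
  consumption_mem : ∀ s ∈ Finset.Icc 1 I.T, ∀ i, h.C s i ∈ Set.Icc (0 : ℝ) 1
  reward_lower : LowerDev h.A I.T h.R I.r (Real.log (1 / δ))
  consumption_upper : ∀ i, UpperDev h.A I.T (fun s => h.C s i) (fun a => I.c a i)
    (Real.log (1 / δ))
  reward_mult : MultDev h.A I.T I.q I.qhi h.R I.r γr (3 * Real.log (1 / δ))
  consumption_mult : ∀ i, MultDev h.A I.T I.q I.qhi (fun s => h.C s i) (fun a => I.c a i) γc
    (3 * Real.log (1 / δ))

theorem Concentrated.regret_le {ε : ℕ → ℝ} {γr γc : ℝ} (hc : Concentrated I h δ γr γc)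
    (hF : I.IsOracle F) (hε : ∀ t ∈ Finset.Icc 1 I.T, |I.pred F t - I.Q| ≤ ε t)
    (hL : 1 ≤ Real.log (1 / δ)) (hlog : 2 + Real.log I.T ≤ 2 * Real.log (1 / δ))
    (hA : FollowsOAUCB I F δ h) (hr0 : 0 < γr) (hr4 : γr ≤ 1 / 4) (hc0 : 0 < γc)
    (hc4 : γc ≤ 1 / 4)
    (hγr : I.qhi * Fintype.card 𝒜 * Real.log (1 / δ) ^ 2 = γr ^ 2 * I.optLP)
    (hγc : I.qhi * Fintype.card 𝒜 * Real.log (1 / δ) ^ 2 = γc ^ 2 * I.B) {n : ℕ}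
    (hn : I.stopTime h = n + 1) (hnT : n ≤ I.T) :
    I.optLP - ∑ t ∈ Finset.Icc 1 n, I.q t * h.R t ≤
      29 * γr * I.optLP + 23 * γc * I.optLP +
        (1 / I.Q + 1 / I.B) * ∑ t ∈ Finset.Icc 1 n, I.q t * ε t +
        4 * ((I.qhi + I.qhi ^ 2 / I.b) * √(n * Real.log ((d : ℝ) + 1))) := by
  have hO := I.optLP_nonneg
  have h1 := le_sum_ucb hF hε (by linarith) hA
    (fun t ht a => le_sampleMean_add_rad hL hc.reward_lower I.r_mem
      (fun s hs => (hc.reward_mem s hs).1) ht a)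
    (fun t ht a i => by
      rw [lcb_castSucc]
      exact sampleMean_sub_rad_le hL (hc.consumption_upper i) (fun a => I.c_mem a i) ht a)
    (s := 23 * γc) (by linarith)
    (fun n i hn hover => le_sum_lcb hc0 hc4 hL hlog hγc
      (fun s hs => hc.consumption_mem s hs i) (hc.consumption_mult i) hn hover) hn hnT
  have h2 := sum_ucb_le hO hr0 hr4 hL hlog hγr hc.reward_mem hc.reward_mult hnT
  have hE0 : 0 ≤ (1 / I.Q + 1 / I.B) * ∑ t ∈ Finset.Icc 1 n, I.q t * ε t := by
    have := I.Q_pos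
    have := I.B_pos
    refine mul_nonneg (by positivity) (Finset.sum_nonneg fun t ht => ?_)
    have ht' := Finset.Icc_subset_Icc_right hnT ht
    exact mul_nonneg (I.q_pos ht').le ((abs_nonneg _).trans (hε t ht'))
  have hD0 : 0 ≤ (I.qhi + I.qhi ^ 2 / I.b) * √(n * Real.log ((d : ℝ) + 1)) := by
    have := I.qhi_pos
    have := I.b_pos
    positivity
  -- The factor 1 - 4γr costs 4γr·OPT, whence 29 = 4 + 25, and only shrinks the other errors.
  have h3 := mul_le_mul_of_nonneg_left h1 (show 0 ≤ 1 - 4 * γr by linarith)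
  have h4 : 0 ≤ γc * I.optLP := by positivity
  nlinarith [mul_nonneg hr0.le hE0, mul_nonneg hr0.le hD0, mul_nonneg hr0.le h4]

end Regret

/-! ### The probability of the favourable event -/

theorem measureReal_not_mem_unit {𝒜 : Type*} [Fintype 𝒜] {d : ℕ} {Ω : Type*}
    {mΩ : MeasurableSpace Ω} {I : Instance 𝒜 d} {Pr : Measure Ω} [IsProbabilityMeasure Pr]
    {ℱ : Filtration ℕ mΩ} {H : Ω → Trajectory 𝒜 d} (hI : IsInteraction I Pr ℱ H) :
    Pr.real {ω | ¬ ((∀ s ∈ Finset.Icc 1 I.T, (H ω).R s ∈ Set.Icc (0 : ℝ) 1) ∧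
      ∀ s ∈ Finset.Icc 1 I.T, ∀ i, (H ω).C s i ∈ Set.Icc (0 : ℝ) 1)} ≤ 0 := by
  have h1 : ∀ᵐ ω ∂Pr, ∀ s ∈ Finset.Icc 1 I.T, (H ω).R s ∈ Set.Icc (0 : ℝ) 1 :=
    (ae_ball_iff (Finset.countable_toSet _)).2 fun s hs =>
      (isCoordinate_reward I).ae_obs_mem hI hs
  have h2 : ∀ᵐ ω ∂Pr, ∀ s ∈ Finset.Icc 1 I.T, ∀ i, (H ω).C s i ∈ Set.Icc (0 : ℝ) 1 :=
    (ae_ball_iff (Finset.countable_toSet _)).2 fun s hs => ae_all_iff.2 fun i =>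
      (isCoordinate_consumption I i).ae_obs_mem hI hs
  have h3 := h1.and h2
  rw [ae_iff] at h3
  rw [measureReal_def, h3]
  simp

section Probability

variable {𝒜 : Type*} [Fintype 𝒜] [DecidableEq 𝒜] {d : ℕ} {Ω : Type*} {mΩ : MeasurableSpace Ω}
  {I : Instance 𝒜 d} {Pr : Measure Ω} [IsProbabilityMeasure Pr] {ℱ : Filtration ℕ mΩ}
  {H : Ω → Trajectory 𝒜 d} {δ : ℝ}

theorem IsCoordinate.measureReal_not_lowerDev_le {φ : ℝ × (Fin d → ℝ) → ℝ} {m : 𝒜 → ℝ}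
    (hφ : IsCoordinate I φ m) (hI : IsInteraction I Pr ℱ H) {l : ℝ} (hl : 0 ≤ l) :
    Pr.real {ω | ¬ LowerDev (H ω).A I.T (fun s => obs φ H s ω) m l} ≤
      Fintype.card 𝒜 * I.T * Real.exp (-l) :=
  measureReal_not_forall_arm_le fun a _ hn => hφ.arm_lower_tail hI a (Finset.mem_Icc.1 hn).1 hl

theorem IsCoordinate.measureReal_not_upperDev_le {φ : ℝ × (Fin d → ℝ) → ℝ} {m : 𝒜 → ℝ}
    (hφ : IsCoordinate I φ m) (hI : IsInteraction I Pr ℱ H) {l : ℝ} (hl : 0 ≤ l) :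
    Pr.real {ω | ¬ UpperDev (H ω).A I.T (fun s => obs φ H s ω) m l} ≤
      Fintype.card 𝒜 * I.T * Real.exp (-l) :=
  measureReal_not_forall_arm_le fun a n _ => hφ.arm_upper_tail hI a n hl

/-- With N = KT, the union bound gives (1 + d)N(δ + 4δ³). The multiplicative events sit at level 3
log(1/δ), so δ ≤ 1/3 makes 4δ³ ≤ 4δ/9, and 2d · 13/9 ≤ 3d. -/
theorem measureReal_not_concentrated_le (hI : IsInteraction I Pr ℱ H) (hδ : 0 < δ)
    (hδ3 : δ ≤ 1 / 3) {γr γc : ℝ} (hr0 : 0 < γr) (hr1 : γr ≤ 1) (hc0 : 0 < γc) (hc1 : γc ≤ 1) :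
    Pr.real {ω | ¬ Concentrated I (H ω) δ γr γc} ≤ 3 * Fintype.card 𝒜 * I.T * d * δ := by
  have hL : 0 ≤ Real.log (1 / δ) := Real.log_nonneg (by rw [le_div_iff₀ hδ]; linarith)
  have hexp : Real.exp (-Real.log (1 / δ)) = δ := by
    rw [one_div, Real.log_inv, neg_neg, Real.exp_log hδ]
  have hexp3 : Real.exp (-(3 * Real.log (1 / δ))) = δ ^ 3 := by
    have : -(3 * Real.log (1 / δ)) = (3 : ℕ) * -Real.log (1 / δ) := by push_cast; ring
    rw [this, Real.exp_nat_mul, hexp]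
  have e1 := measureReal_not_mem_unit hI
  have e2 := (isCoordinate_reward I).measureReal_not_lowerDev_le hI hL
  have e3 := measureReal_not_forall_le (Finset.univ (α := Fin d)) fun i _ =>
    (isCoordinate_consumption I i).measureReal_not_upperDev_le hI hL
  have e4 := (isCoordinate_reward I).measureReal_not_multDev_le hI hr0 hr1
    (3 * Real.log (1 / δ))
  have e5 := measureReal_not_forall_le (Finset.univ (α := Fin d)) fun i _ =>
    (isCoordinate_consumption I i).measureReal_not_multDev_le hI hc0 hc1 (3 * Real.log (1 / δ))
  rw [hexp] at e2 e3
  rw [hexp3] at e4 e5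
  rw [Finset.card_univ, Fintype.card_fin] at e3 e5
  have e := measureReal_not_and_le (measureReal_not_and_le e1 (measureReal_not_and_le e2 e3))
    (measureReal_not_and_le e4 e5)
  refine (measureReal_mono ?_).trans (e.trans ?_)
  · exact fun ω hω h => hω ⟨h.1.1.1, h.1.1.2, h.1.2.1, fun i => h.1.2.2 i (Finset.mem_univ i),
      h.2.1, fun i => h.2.2 i (Finset.mem_univ i)⟩
  · set N : ℝ := Fintype.card 𝒜 * I.T with hN
    have hd : (1 : ℝ) ≤ d := by exact_mod_cast I.one_le_d
    have hN0 : 0 ≤ N := by positivity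
    have h1 : N * δ ≤ d * (N * δ) := le_mul_of_one_le_left (by positivity) hd
    have h2 : N * δ ^ 3 ≤ d * (N * δ ^ 3) := le_mul_of_one_le_left (by positivity) hd
    have h3 : δ ^ 3 ≤ δ / 9 := by nlinarith [mul_pos hδ hδ]
    have h4 : d * (N * δ ^ 3) ≤ d * (N * (δ / 9)) := by gcongr
    have h5 : 0 ≤ d * (N * δ) := by positivity
    linarith

theorem le_measureReal_of_not_le {s : Set Ω} {p : Ω → Prop} {e : ℝ}
    (h : Pr.real {ω | ¬ p ω} ≤ e) (hs : ∀ ω, p ω → ω ∈ s) : 1 - e ≤ Pr.real s := by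
  have h1 : (Set.univ : Set Ω) ⊆ s ∪ {ω | ¬ p ω} := fun ω _ =>
    (em (p ω)).imp (hs ω) id
  have h2 := (measureReal_mono (μ := Pr) h1).trans (measureReal_union_le _ _)
  rw [probReal_univ] at h2
  linarith

end Probability

end OAUCB

/-! ### Choice of the scales and conclusion -/

open OAUCB in
theorem theorem2 :
    ∃ c : ℝ, 0 < c ∧
      ∀ (𝒜 : Type*) [Fintype 𝒜] [DecidableEq 𝒜] (d : ℕ) (I : Instance 𝒜 d)
        (F : Oracle) (_ : I.IsOracle F)
        (ε : ℕ → ℝ) (_ : ∀ t ∈ Finset.Icc 1 I.T, |I.pred F t - I.Q| ≤ ε t)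
        (δ : ℝ) (_ : 0 < δ)
        (Ω : Type*) (mΩ : MeasurableSpace Ω) (Pr : Measure Ω) [IsProbabilityMeasure Pr]
        (ℱ : Filtration ℕ mΩ) (H : Ω → Trajectory 𝒜 d)
        (_ : IsInteraction I Pr ℱ H) (_ : ∀ ω, FollowsOAUCB I F δ (H ω)),
        1 - 3 * (Fintype.card 𝒜 : ℝ) * I.T * d * δ ≤
          Pr.real {ω |
            I.optLP - ∑ t ∈ Finset.Ico 1 (I.stopTime (H ω)), I.q t * (H ω).R t ≤
              c * ((I.optLP * √(I.qhi * Fintype.card 𝒜 / I.B) +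
                    √(I.qhi * Fintype.card 𝒜 * I.optLP)) * Real.log (1 / δ) +
                (1 / I.Q + 1 / I.B) *
                  ∑ t ∈ Finset.Ico 1 (I.stopTime (H ω)), I.q t * ε t +
                (I.qhi + I.qhi ^ 2 / I.b) *
                  √(((I.stopTime (H ω) : ℝ) - 1) * Real.log ((d : ℝ) + 1)))} := by
  -- Dominates 29 (rewards), 23 (consumptions), 4 (AdaHedge) and 4 (the trivial case).
  refine ⟨30, by norm_num, ?_⟩
  intro 𝒜 _ _ d I F hF ε hε δ hδ Ω mΩ Pr _ ℱ H hI hA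
  -- If the failure bound reaches 1 nothing is claimed. Otherwise 3Tδ < 1, which yields δ ≤ 1/3 and
  -- log(1/δ) ≥ 1 + log T.
  rcases le_or_gt 1 (3 * (Fintype.card 𝒜 : ℝ) * I.T * d * δ) with hbig | hsmall
  · have := measureReal_nonneg (μ := Pr) (s := {ω |
      I.optLP - ∑ t ∈ Finset.Ico 1 (I.stopTime (H ω)), I.q t * (H ω).R t ≤
        30 * ((I.optLP * √(I.qhi * Fintype.card 𝒜 / I.B) +
              √(I.qhi * Fintype.card 𝒜 * I.optLP)) * Real.log (1 / δ) +
          (1 / I.Q + 1 / I.B) *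
            ∑ t ∈ Finset.Ico 1 (I.stopTime (H ω)), I.q t * ε t +
          (I.qhi + I.qhi ^ 2 / I.b) *
            √(((I.stopTime (H ω) : ℝ) - 1) * Real.log ((d : ℝ) + 1)))})
    linarith
  have hK := one_le_card I
  have hd : (1 : ℝ) ≤ d := by exact_mod_cast I.one_le_d
  have hT1 : (1 : ℝ) ≤ I.T := by exact_mod_cast I.one_le_T
  have hQ := I.Q_pos
  have hB := I.B_pos
  have hq := I.qhi_pos
  have hb := I.b_pos
  have hO := I.optLP_nonneg
  have hT3 : 3 * (I.T : ℝ) * δ ≤ 3 * (Fintype.card 𝒜 : ℝ) * I.T * d * δ := by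
    have h1 : (1 : ℝ) ≤ Fintype.card 𝒜 * d := one_le_mul_of_one_le_of_one_le hK hd
    have h2 : 3 * (I.T : ℝ) * δ ≤ 3 * (I.T : ℝ) * δ * (Fintype.card 𝒜 * d) :=
      le_mul_of_one_le_right (by positivity) h1
    linarith
  have hδ3 : δ ≤ 1 / 3 := by nlinarith
  have hlog3 : 1 ≤ Real.log 3 := by
    rw [Real.le_log_iff_exp_le (by norm_num)]
    linarith [Real.exp_one_lt_d9]
  have hLT : 1 + Real.log I.T ≤ Real.log (1 / δ) := by
    have h1 : Real.log (3 * I.T) ≤ Real.log (1 / δ) := by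
      refine Real.log_le_log (by positivity) ?_
      rw [le_div_iff₀ hδ]
      linarith
    rw [Real.log_mul (by norm_num) (by positivity)] at h1
    linarith
  have hlogT : 0 ≤ Real.log (I.T : ℝ) := Real.log_nonneg hT1
  set L := Real.log (1 / δ) with hLdef
  have hL : 1 ≤ L := by linarith
  have hlog : 2 + Real.log I.T ≤ 2 * L := by linarith
  set K : ℝ := (Fintype.card 𝒜 : ℝ) with hKdef
  set γc : ℝ := √(I.qhi * K / I.B) * L with hγc
  set G : ℝ := √(I.qhi * K * I.optLP) * L with hG
  have hc0 : 0 < γc := by positivity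
  have hG0 : 0 ≤ G := by positivity
  have hn : ∀ ω, ∃ n, I.stopTime (H ω) = n + 1 ∧ n ≤ I.T := fun ω => by
    rcases I.stopTime_mem (H ω) with h | ⟨h, -⟩
    · exact ⟨I.T, h, le_rfl⟩
    · have := Finset.mem_Icc.1 h
      exact ⟨I.stopTime (H ω) - 1, by omega, by omega⟩
  have hE0 : ∀ n ≤ I.T, 0 ≤ (1 / I.Q + 1 / I.B) * ∑ t ∈ Finset.Icc 1 n, I.q t * ε t := by
    refine fun n hn => mul_nonneg (by positivity) (Finset.sum_nonneg fun t ht => ?_)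
    have ht' := Finset.Icc_subset_Icc_right hn ht
    exact mul_nonneg (I.q_pos ht').le ((abs_nonneg _).trans (hε t ht'))
  -- The scales are γr = G/OPT and γc. When one of them exceeds 1/4, or OPT = 0, already OPT ≤
  -- 4(γc·OPT + G), and nonnegative rewards suffice.
  by_cases hcase : 4 * G ≤ I.optLP ∧ γc ≤ 1 / 4 ∧ 0 < I.optLP
  · obtain ⟨hG4, hc4, hOpos⟩ := hcase
    have hGpos : 0 < G := by positivity
    have hγr : G / I.optLP * I.optLP = G := div_mul_cancel₀ _ hOpos.ne'
    have hr4 : G / I.optLP ≤ 1 / 4 := by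
      rw [div_le_iff₀ hOpos]
      linarith
    have hr0 : 0 < G / I.optLP := div_pos hGpos hOpos
    refine le_measureReal_of_not_le (measureReal_not_concentrated_le hI hδ hδ3 hr0
      (by linarith) hc0 (by linarith)) fun ω hω => ?_
    obtain ⟨n, hn, hnT⟩ := hn ω
    have hsq1 : I.qhi * K * L ^ 2 = (G / I.optLP) ^ 2 * I.optLP := by
      rw [div_pow, hG, mul_pow, Real.sq_sqrt (by positivity)]
      field_simp
    have hsq2 : I.qhi * K * L ^ 2 = γc ^ 2 * I.B := by
      rw [hγc, mul_pow, Real.sq_sqrt (by positivity)]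
      field_simp
    have h1 := hω.regret_le hF hε hL hlog (hA ω) hr0 hr4 hc0 hc4 hsq1 hsq2 hn hnT
    have h2 := hE0 n hnT
    have h3 : 0 ≤ (I.qhi + I.qhi ^ 2 / I.b) * √(n * Real.log ((d : ℝ) + 1)) := by positivity
    have h4 : 0 ≤ γc * I.optLP := by positivity
    rw [Set.mem_ofPred_eq, hn, Finset.Ico_add_one_right_eq_Icc]
    push_cast
    rw [add_sub_cancel_right]
    have h5 : (I.optLP * √(I.qhi * K / I.B) + √(I.qhi * K * I.optLP)) * L =
        γc * I.optLP + G := by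
      rw [hγc, hG]
      ring
    rw [h5]
    rw [mul_assoc 29, hγr] at h1
    linarith
  · have htriv : I.optLP ≤ 4 * (γc * I.optLP + G) := by
      by_contra! hlt
      refine hcase ⟨?_, ?_, ?_⟩
      · nlinarith [mul_nonneg hc0.le hO]
      · by_contra! h
        nlinarith
      · nlinarith [mul_nonneg hc0.le hO]
    have hp : (0 : ℝ) ≤ 3 * K * I.T * d * δ := by positivity
    refine le_measureReal_of_not_le ((measureReal_not_mem_unit hI).trans hp) fun ω hω => ?_
    obtain ⟨n, hn, hnT⟩ := hn ω
    have h2 := hE0 n hnT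
    have h3 : 0 ≤ (I.qhi + I.qhi ^ 2 / I.b) * √(n * Real.log ((d : ℝ) + 1)) := by positivity
    have h4 : 0 ≤ γc * I.optLP := by positivity
    have h6 : 0 ≤ ∑ t ∈ Finset.Icc 1 n, I.q t * (H ω).R t := Finset.sum_nonneg fun t ht => by
      have ht' := Finset.Icc_subset_Icc_right hnT ht
      exact mul_nonneg (I.q_pos ht').le (hω.1 t ht').1
    rw [Set.mem_ofPred_eq, hn, Finset.Ico_add_one_right_eq_Icc]
    push_cast
    rw [add_sub_cancel_right]
    have h5 : (I.optLP * √(I.qhi * K / I.B) + √(I.qhi * K * I.optLP)) * L =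
        γc * I.optLP + G := by
      rw [hγc, hG]
      ring
    rw [h5]
    linarith
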